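/- Let $m,n\ge 0$ be integers with $m+n\ge 1$ and let $a_1,\dots,a_m,b_1,\dots,b_n\in\mathbb R$. On a probability space consider the ARX system $$y_k+a_1y_{k-1}+\dots+a_my_{k-m}=b_1u_{k-1}+\dots+b_nu_{k-n}+d_k,\qquad k\ge 1,$$ with real random outputs $y_k$, inputs $u_k$ and noises $d_k$, where $y_k=0$ for $k\le 0$ and $u_k=0$ for $k<0$. Put $\theta=[a_1,\dots,a_m,b_1,\dots,b_n]^T$ and $\phi_k=[-y_{k-1},\dots,-y_{k-m},u_{k-1},\dots,u_{k-n}]^T$, and write $\bar{\mathbb E}[\{x_k\}]=\lim_{k\to\infty}\frac1k\sum_{l=1}^k\mathbb E[x_l]$. A process $\{x_k\}$ (set to $0$ before its initial time) is called quasi-stationary if $\mathbb E[x_k]$ and $\mathbb E[x_ix_j]$ are bounded uniformly in $k$, $i$, $j$, and $\bar{\mathbb E}[\{x_kx_{k-\tau}\}]$ exists for every $\tau\in\mathbb Z$. Assume the following. **Assumption 1.** There are a bounded deterministic sequence $\{r_k\}_{k\ge 0}$, a sequence $\{e_k\}_{k\ge 0}$ of independent random variables with zero mean, common variance $\delta_e^2$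 and, for every positive integer $p$, $\sup_k\mathbb E|e_k|^p<\infty$, and real coefficients $f_i^{(j)}(k)$ such that, with $r_t=0$ and $e_t=0$ for $t<0$, almost surely for every $k\ge 1$, $$y_k=\sum_{i\ge 1}f^{(1)}_i(k)r_{k-i}+\sum_{i\ge 0}f^{(2)}_i(k)e_{k-i},\qquad u_k=\sum_{i\ge 0}f^{(3)}_i(k)r_{k-i}+\sum_{i\ge 0}f^{(4)}_i(k)e_{k-i}.$$ Moreover: (i) there is a sequence $\{f_i\}_{i\ge1}$ with $\sum_{i\ge 1}|f_i|<\infty$ and $|f^{(j)}_i(k)|\le|f_i|$ for all $i,k\ge 1$ and $j=1,2,3,4$; (ii) $\{y_k\}_{k\ge 1}$ and $\{u_k\}_{k\ge 0}$ are quasi-stationary and $\bar{\mathbb E}[\{y_ku_{k-\tau}\}]$ exists for every $\tau\in\mathbb Z$; (iii) $\bar{\mathbb E}[\{\phi_k\phi_k^T\}]$ is positive definite. **Assumption 2.** $1+a_1z^{-1}+\dots+a_mz^{-m}\ne 0$ for all complex $z$ with $|z|\ge 1$. **Assumption 3.** The noises $d_1,d_2,\dots$ are independent and $\mathcal N(0,\delta_d^2)$-distributed,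 and for every $k\ge 1$ the noise $d_k$ is independent of the data $(y_j,u_j)_{0\le j<k}$ observed before time $k$. The RLS-SA algorithm takes initial values $\hat\theta_0,\hat\theta^{\mathrm{RLS}}_0\in\mathbb R^{m+n}$, a symmetric positive definite matrix $P_0$, a number $\alpha\in(1/2,1)$, and step-size coefficients with $0<\underline\beta\le\beta_k\le\bar\beta<\infty$, and sets, for $k\ge 1$, $$g_k=(1+\phi_k^TP_{k-1}\phi_k)^{-1},\qquad \hat\theta^{\mathrm{RLS}}_k=\hat\theta^{\mathrm{RLS}}_{k-1}+g_kP_{k-1}\phi_k\bigl(y_k-\phi_k^T\hat\theta^{\mathrm{RLS}}_{k-1}\bigr),\qquad P_k=P_{k-1}-g_kP_{k-1}\phi_k\phi_k^TP_{k-1},$$ $$s_k=\begin{cases}1,& x_k^T\hat\theta^{\mathrm{RLS}}_k>x_k^T\hat\theta_{k-1},\\-1,& x_k^T\hat\theta^{\mathrm{RLS}}_k\le x_k^T\hat\theta_{k-1},\end{cases}\qquad \hat\theta_k=\hat\theta_{k-1}+\beta_kx_k\frac{s_k}{k^{\alpha}},$$ where $x_k$ is the unit vector whose $(\mathrm{mod}(k,m+n)+1)$-th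 coordinate is $1$. Then, almost surely, $\hat\theta_k\to\theta$ as $k\to\infty$ and, in the Euclidean norm, $$\|\hat\theta_k-\theta\|=O\!\left(\sqrt{\frac{\log k}{k}}\right).$$ -/

import Mathlib

open MeasureTheory ProbabilityTheory Filter Topology Asymptotics Matrix

namespace RLSSA

noncomputable section

/-! ### The ARX system -/

/-- The parameter vector `θ = [a₁, …, a_m, b₁, …, b_n]ᵀ`; the entry `a i` (`i : Fin m`) is the
coefficient `a_{i+1}`, and `b j` is `b_{j+1}`. -/
def param {m n : ℕ} (a : Fin m → ℝ) (b : Fin n → ℝ) : Fin (m + n) → ℝ :=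
  Fin.append a b

/-- The regression vector `φ_k = [-y_{k-1}, …, -y_{k-m}, u_{k-1}, …, u_{k-n}]ᵀ`
built from one trajectory of the output and of the input. -/
def regressor (m n : ℕ) (y u : ℤ → ℝ) (k : ℕ) : Fin (m + n) → ℝ :=
  Fin.append (fun i : Fin m => -y ((k : ℤ) - 1 - ((i : ℕ) : ℤ)))
    (fun j : Fin n => u ((k : ℤ) - 1 - ((j : ℕ) : ℤ)))

/-- The ARX system `A(q) y_k = B(q) u_k + d_k`, `k ≥ 1`, with `y_k = 0` for `k ≤ 0` and
`u_k = 0` for `k < 0`; here `A(q) = 1 + a₁ q⁻¹ + … + a_m q⁻ᵐ` and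
`B(q) = b₁ q⁻¹ + … + b_n q⁻ⁿ`. -/
structure IsARX {Ω : Type*} [MeasurableSpace Ω] (μ : Measure Ω) {m n : ℕ}
    (a : Fin m → ℝ) (b : Fin n → ℝ) (y u : ℤ → Ω → ℝ) (d : ℕ → Ω → ℝ) : Prop where
  measurable_output : ∀ k, Measurable (y k)
  measurable_input : ∀ k, Measurable (u k)
  output_zero : ∀ k : ℤ, k ≤ 0 → ∀ ω, y k ω = 0
  input_zero : ∀ k : ℤ, k < 0 → ∀ ω, u k ω = 0
  equation : ∀ k : ℕ, 1 ≤ k → ∀ᵐ ω ∂μ,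
    y k ω + ∑ i : Fin m, a i * y ((k : ℤ) - 1 - ((i : ℕ) : ℤ)) ω
      = ∑ j : Fin n, b j * u ((k : ℤ) - 1 - ((j : ℕ) : ℤ)) ω + d k ω

/-! ### Time averages and quasi-stationarity -/

/-- `c` is the limit of `(1/k) ∑_{l=1}^k E[x_l]` as `k → ∞`. -/
def HasMeanAverage {Ω : Type*} [MeasurableSpace Ω] (μ : Measure Ω)
    (x : ℕ → Ω → ℝ) (c : ℝ) : Prop :=
  Tendsto (fun k : ℕ => (k : ℝ)⁻¹ * ∑ l ∈ Finset.Icc 1 k, ∫ ω, x l ω ∂μ) atTop (𝓝 c)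

/-- Quasi-stationarity: uniformly bounded first and second moments, and existence of all the
averaged covariances. A process that starts at time `0` or `1` is extended by zero to negative
times. -/
structure QuasiStationary {Ω : Type*} [MeasurableSpace Ω] (μ : Measure Ω)
    (x : ℤ → Ω → ℝ) : Prop where
  memLp : ∀ k, MemLp (x k) 2 μ
  bounded : ∃ C : ℝ, (∀ k, |∫ ω, x k ω ∂μ| < C) ∧ ∀ i j, |∫ ω, x i ω * x j ω ∂μ| < C
  covariance : ∀ τ : ℤ, ∃ R : ℝ,
    HasMeanAverage μ (fun (k : ℕ) ω => x k ω * x ((k : ℤ) - τ) ω) R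

/-! ### The assumptions -/

/-- The input-output data are generated by a bounded deterministic sequence `r` and a sequence
`e` of independent centred random variables with variance `δe2` and bounded moments, through four
uniformly stable families of time-varying filters; `f₁ k i` is the `i`-th coefficient of the
first filter at time `k`. The sequences `r` and `e` start at time `0`, so the filter sums stop at
the lag `i = k`. -/
structure GeneratedBy {Ω : Type*} [MeasurableSpace Ω] (μ : Measure Ω) (y u : ℤ → Ω → ℝ)
    (r : ℕ → ℝ) (e : ℕ → Ω → ℝ) (δe2 : ℝ) (f₁ f₂ f₃ f₄ : ℕ → ℕ → ℝ) : Prop where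
  bounded_r : ∃ C : ℝ, ∀ k, |r k| ≤ C
  measurable_e : ∀ k, Measurable (e k)
  indep_e : iIndepFun e μ
  mean_e : ∀ k, ∫ ω, e k ω ∂μ = 0
  variance_e : ∀ k, variance (e k) μ = δe2
  moments_e : ∀ p : ℕ, 1 ≤ p → ∃ C : ℝ, ∀ k,
    Integrable (fun ω => |e k ω| ^ p) μ ∧ ∫ ω, |e k ω| ^ p ∂μ ≤ C
  output_eq : ∀ k : ℕ, 1 ≤ k → ∀ᵐ ω ∂μ,
    y k ω = ∑ i ∈ Finset.Icc 1 k, f₁ k i * r (k - i)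
      + ∑ i ∈ Finset.range (k + 1), f₂ k i * e (k - i) ω
  input_eq : ∀ k : ℕ, 1 ≤ k → ∀ᵐ ω ∂μ,
    u k ω = ∑ i ∈ Finset.range (k + 1), f₃ k i * r (k - i)
      + ∑ i ∈ Finset.range (k + 1), f₄ k i * e (k - i) ω
  uniformly_stable : ∃ g : ℕ → ℝ, Summable (fun i => |g i|) ∧
    ∀ k i : ℕ, 1 ≤ k → 1 ≤ i →
      |f₁ k i| ≤ |g i| ∧ |f₂ k i| ≤ |g i| ∧ |f₃ k i| ≤ |g i| ∧ |f₄ k i| ≤ |g i|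

/-- The assumption on the input-output data: generation by uniformly stable filters, joint
quasi-stationarity, and persistent excitation. -/
structure DataAssumption {Ω : Type*} [MeasurableSpace Ω] (μ : Measure Ω) (m n : ℕ)
    (y u : ℤ → Ω → ℝ) : Prop where
  generated : ∃ (r : ℕ → ℝ) (e : ℕ → Ω → ℝ) (δe2 : ℝ) (f₁ f₂ f₃ f₄ : ℕ → ℕ → ℝ),
    GeneratedBy μ y u r e δe2 f₁ f₂ f₃ f₄
  quasiStationary_output : QuasiStationary μ y
  quasiStationary_input : QuasiStationary μ u
  cross_covariance : ∀ τ : ℤ, ∃ R : ℝ,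
    HasMeanAverage μ (fun (k : ℕ) ω => y k ω * u ((k : ℤ) - τ) ω) R
  persistent_excitation : ∃ M : Matrix (Fin (m + n)) (Fin (m + n)) ℝ, M.PosDef ∧
    ∀ i j, HasMeanAverage μ (fun k ω =>
      regressor m n (fun t => y t ω) (fun t => u t ω) k i
        * regressor m n (fun t => y t ω) (fun t => u t ω) k j) (M i j)

/-- Stability of the ARX model: all zeros of `A`, i.e. all poles of the transfer function
`1 / A`, lie strictly inside the unit circle. -/
def StableModel {m : ℕ} (a : Fin m → ℝ) : Prop :=
  ∀ z : ℂ, 1 ≤ ‖z‖ → 1 + ∑ i : Fin m, (a i : ℂ) * z⁻¹ ^ ((i : ℕ) + 1) ≠ 0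

/-- The assumption on the observation noise: `d₁, d₂, …` are independent, each with the Gaussian
law of mean zero and variance `δd2`, and `d_k` is independent of the data
`(y_j, u_j)`, `j < k`, observed before time `k`. -/
structure NoiseAssumption {Ω : Type*} [MeasurableSpace Ω] (μ : Measure Ω)
    (y u : ℤ → Ω → ℝ) (d : ℕ → Ω → ℝ) (δd2 : NNReal) : Prop where
  measurable : ∀ k, 1 ≤ k → Measurable (d k)
  indep : iIndepFun (fun k : ℕ => d (k + 1)) μ
  gaussian : ∀ k, 1 ≤ k → μ.map (d k) = gaussianReal 0 δd2
  indep_past : ∀ k, 1 ≤ k →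
    IndepFun (d k) (fun ω (j : Fin k) => (y ((j : ℕ) : ℤ) ω, u ((j : ℕ) : ℤ) ω)) μ

/-! ### The RLS-SA algorithm, along one trajectory -/

/-- The scalar `(1 + φᵀ P φ)⁻¹`. -/
def rlsGain {N : ℕ} (P : Matrix (Fin N) (Fin N) ℝ) (φ : Fin N → ℝ) : ℝ :=
  (1 + φ ⬝ᵥ (P *ᵥ φ))⁻¹

/-- The matrices `P_k` of the recursive least squares algorithm. -/
def rlsCov {N : ℕ} (P₀ : Matrix (Fin N) (Fin N) ℝ) (φ : ℕ → Fin N → ℝ) :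
    ℕ → Matrix (Fin N) (Fin N) ℝ
  | 0 => P₀
  | k + 1 =>
    rlsCov P₀ φ k - rlsGain (rlsCov P₀ φ k) (φ (k + 1)) •
      (rlsCov P₀ φ k * vecMulVec (φ (k + 1)) (φ (k + 1)) * rlsCov P₀ φ k)

/-- The recursive least squares estimates, from regressors `φ` and outputs `y`. -/
def rlsEstimate {N : ℕ} (P₀ : Matrix (Fin N) (Fin N) ℝ) (ϑ₀ : Fin N → ℝ)
    (φ : ℕ → Fin N → ℝ) (y : ℕ → ℝ) : ℕ → Fin N → ℝ
  | 0 => ϑ₀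
  | k + 1 =>
    rlsEstimate P₀ ϑ₀ φ y k
      + (rlsGain (rlsCov P₀ φ k) (φ (k + 1))
          * (y (k + 1) - φ (k + 1) ⬝ᵥ rlsEstimate P₀ ϑ₀ φ y k)) •
        (rlsCov P₀ φ k *ᵥ φ (k + 1))

/-- The unit vector `x_k` that selects the coordinate number `mod(k, N) + 1`, coordinates being
numbered from `1`, i.e. the element `mod(k, N)` of `Fin N`. -/
def selector (N k : ℕ) : Fin N → ℝ := fun i => if (i : ℕ) = k % N then 1 else 0

open Classical in
/-- The transmitted bit: `1` if `xᵀ ϑ > xᵀ η`, and `-1` if `xᵀ ϑ ≤ xᵀ η`. -/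
def oneBit {N : ℕ} (x ϑ η : Fin N → ℝ) : ℝ := if x ⬝ᵥ η < x ⬝ᵥ ϑ then 1 else -1

/-- The remote estimates, driven by the one-bit comparison of the local estimates `ϑ` with the
previous remote estimate. -/
def remoteEstimate {N : ℕ} (α : ℝ) (β : ℕ → ℝ) (η₀ : Fin N → ℝ) (ϑ : ℕ → Fin N → ℝ) :
    ℕ → Fin N → ℝ
  | 0 => η₀
  | k + 1 =>
    remoteEstimate α β η₀ ϑ k
      + (β (k + 1) * (oneBit (selector N (k + 1)) (ϑ (k + 1)) (remoteEstimate α β η₀ ϑ k)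
          / ((k + 1 : ℕ) : ℝ) ^ α)) • selector N (k + 1)

/-- The remote estimate of the RLS-SA algorithm computed from the trajectories of `y` and `u`. -/
def rlssa {m n : ℕ} (P₀ : Matrix (Fin (m + n)) (Fin (m + n)) ℝ) (ϑ₀ η₀ : Fin (m + n) → ℝ)
    (α : ℝ) (β : ℕ → ℝ) (y u : ℤ → ℝ) : ℕ → Fin (m + n) → ℝ :=
  remoteEstimate α β η₀
    (rlsEstimate P₀ ϑ₀ (regressor m n y u) (fun k : ℕ => y (k : ℤ)))

/-- The Euclidean norm of a vector. -/
def euclNorm {N : ℕ} (v : Fin N → ℝ) : ℝ := ‖WithLp.toLp 2 v‖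

end

end RLSSA

namespace RLSSA

/-! ### Tracking by the one-bit stochastic approximation recursion -/

/-! Two estimates are combined: the least squares error is `O(√(log k / k))`, and the one-bit
recursion follows its target at that same rate. Least squares: the information matrix `R_k = P₀⁻¹ +
∑ φ φᵀ` is the inverse of `P_k`, and `R_k` times the error equals a constant vector plus `∑ w φ`,
with `w` the equation error. Thus it suffices that `R_k / k` tends almost surely to a positive
definite matrix and that `∑ w φ` is `O(√(k log k))`. The first point is a strong law. The data are
bounded deterministic sequences plus uniformly stable filters of independent variables, so a partial
sum of squares is, once centred, a linear plus a quadratic form in those variables. Distinct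
unordered pairs of innovations have uncorrelated products, which makes the variance of `K` terms
`O(K)`; Chebyshev's bound along `K = n²` and monotonicity give the squares, and polarization gives
the mixed products (`IsInnovation.variance_sum_sq_le`, `ae_tendsto_average_of_variance_le`). The
second point uses that the regressor is a function of the past, of which the Gaussian noise is
independent: the exponential martingale has mean one, and a Borel–Cantelli argument with parameter
`±√(log k / k)` yields the rate (`ae_sum_mul_div_isBigO`). One-bit recursion: each coordinate moves
once per cycle, by about `k^(-α)`, towards its target. Since `∑ k^(-α)` diverges, it enters a tube
of width `C √(log k / k)`. It stays there because `α > 1/2` makes the overshoot at most the order of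
the width, and `α < 1` makes the steps eventually larger than the `O(1/k)` by which the tube shrinks
in a cycle. -/

theorem eventually_abs_le_of_step {Z F t : ℕ → ℝ} (ht : ∀ j, 0 ≤ t j) (hsum : ¬ Summable t)
    (hstep : ∀ᶠ j in atTop, |Z (j + 1)| ≤ max (|Z j| - t j) (F (j + 1)))
    (hdecr : ∀ᶠ j in atTop, F j - t j ≤ F (j + 1)) : ∀ᶠ j in atTop, |Z j| ≤ F j := by
  obtain ⟨J, hJ⟩ := eventually_atTop.1 (hstep.and hdecr)
  have hkeep : ∀ j, J ≤ j → |Z j| ≤ F j → |Z (j + 1)| ≤ F (j + 1) := fun j hj h =>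
    (hJ j hj).1.trans (max_le ((sub_le_sub_right h _).trans (hJ j hj).2) le_rfl)
  by_cases hex : ∃ j, J ≤ j ∧ |Z j| ≤ F j
  · obtain ⟨j₀, hj₀, h⟩ := hex
    refine eventually_atTop.2 ⟨j₀, fun j hj => ?_⟩
    induction j, hj using Nat.le_induction with
    | base => exact h
    | succ j hj ih => exact hkeep j (hj₀.trans hj) ih
  -- Outside the tube the second branch of the maximum is impossible, so every step lowers `|Z|` by
  -- at least `t j`. As `|Z| ≥ 0`, this would make `t` summable.
  · push Not at hex
    exfalso
    have hdec : ∀ j, |Z (J + j)| + ∑ l ∈ Finset.range j, t (l + J) ≤ |Z J| := by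
      intro j
      induction j with
      | zero => simp
      | succ j ih =>
        have h1 := (hJ (J + j) (by omega)).1
        have h2 := hex (J + j + 1) (by omega)
        rcases le_max_iff.1 h1 with h | h
        · rw [Finset.sum_range_succ, add_comm j J]
          rw [show J + (j + 1) = J + j + 1 by ring]
          linarith
        · linarith
    refine hsum ((summable_nat_add_iff J).1 ?_)
    refine summable_of_sum_range_le (c := |Z J|) (fun j => ht _) fun j => ?_
    linarith [hdec j, abs_nonneg (Z (J + j))]

/-- The tube narrows by only `O(1/k)` over a cycle of `N` steps. With `b` the later width and `c =
log k / (k + N)`, one has `log k / k = c + c N / k`. From `c ≤ b²` and `c ≤ 1` follows `c ≤ b`, so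
the right side is at most `(b + N / k)²`. -/
theorem sqrt_log_div_le_add {k N : ℕ} (hk : 1 ≤ k) :
    Real.sqrt (Real.log k / k) ≤ Real.sqrt (Real.log (k + N : ℕ) / (k + N : ℕ)) + N / k := by
  have hk0 : (0 : ℝ) < k := by exact_mod_cast hk
  have hkN : (0 : ℝ) < k + N := by positivity
  have hlog : 0 ≤ Real.log k := Real.log_natCast_nonneg k
  push_cast
  set b := Real.sqrt (Real.log (k + N) / (k + N)) with hb
  have hb0 : 0 ≤ b := Real.sqrt_nonneg _
  have hmono : Real.log k ≤ Real.log (k + N) := Real.log_le_log hk0 (by simp)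
  have hbsq : b ^ 2 = Real.log (k + N) / (k + N) :=
    Real.sq_sqrt (div_nonneg (hlog.trans hmono) hkN.le)
  set c := Real.log k / (k + N) with hc
  have hc0 : 0 ≤ c := div_nonneg hlog hkN.le
  have hcb : c ≤ b ^ 2 := by rw [hbsq]; exact div_le_div_of_nonneg_right hmono hkN.le
  have hc1 : c ≤ 1 := by
    rw [hc, div_le_one hkN]
    have := Real.log_le_sub_one_of_pos hk0
    have : (0 : ℝ) ≤ N := by positivity
    linarith
  have hcb' : c ≤ b := by
    by_contra h
    push Not at h
    nlinarith
  apply Real.sqrt_le_iff.2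
  refine ⟨by positivity, ?_⟩
  have hsplit : Real.log k / k = c + c * (N / k) := by
    rw [hc]; field_simp
  rw [hsplit]
  have hN : (0 : ℝ) ≤ N / k := by positivity
  nlinarith [mul_le_mul_of_nonneg_right hcb' hN, mul_nonneg hb0 hN]

/-- This is where `α > 1/2` matters: squaring gives `k^(-2α) ≤ 1/k ≤ log k / k`. It bounds the
overshoot of a step and, with `α = 1`, the influence of the initial values of least squares. -/
theorem inv_rpow_isBigO_sqrt_log_div {α : ℝ} (hα : 1 / 2 < α) :
    (fun k : ℕ => 1 / (k : ℝ) ^ α) =O[atTop] fun k : ℕ => Real.sqrt (Real.log k / k) := by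
  refine IsBigO.of_bound 1 ?_
  have hlog : ∀ᶠ k : ℕ in atTop, 1 ≤ Real.log k :=
    (Real.tendsto_log_atTop.comp tendsto_natCast_atTop_atTop).eventually_ge_atTop 1
  filter_upwards [hlog, eventually_ge_atTop 1] with k hl hk
  have hk1 : (1 : ℝ) ≤ k := by exact_mod_cast hk
  have hk0 : (0 : ℝ) < k := by linarith
  rw [one_mul, Real.norm_of_nonneg (by positivity), Real.norm_of_nonneg (Real.sqrt_nonneg _)]
  apply Real.le_sqrt_of_sq_le
  rw [div_pow, one_pow, ← Real.rpow_natCast, ← Real.rpow_mul hk0.le]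
  have : (k : ℝ) ≤ (k : ℝ) ^ (α * (2 : ℕ)) := by
    conv_lhs => rw [← Real.rpow_one (k : ℝ)]
    exact Real.rpow_le_rpow_of_exponent_le hk1 (by push_cast; linarith)
  calc 1 / (k : ℝ) ^ (α * (2 : ℕ)) ≤ 1 / k := one_div_le_one_div_of_le hk0 this
    _ ≤ Real.log k / k := div_le_div_of_nonneg_right hl hk0.le

theorem eventually_div_le_div_rpow_add {α c : ℝ} (hα : 0 < α) (hα' : α < 1) (hc : 0 < c) (C : ℝ)
    (N : ℕ) : ∀ᶠ k : ℕ in atTop, C / k ≤ c / ((k + N : ℕ) : ℝ) ^ α := by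
  have h1 : Tendsto (fun k : ℕ => (k : ℝ) ^ (1 - α)) atTop atTop :=
    (tendsto_rpow_atTop (by linarith)).comp tendsto_natCast_atTop_atTop
  filter_upwards [h1.eventually_ge_atTop (|C| * 2 ^ α / c), eventually_ge_atTop (N + 1)]
    with k hk hkN
  have hk0 : (0 : ℝ) < k := by exact_mod_cast (by omega : 0 < k)
  have h2 : ((k + N : ℕ) : ℝ) ^ α ≤ 2 ^ α * (k : ℝ) ^ α := by
    rw [← Real.mul_rpow (by norm_num) hk0.le]
    refine Real.rpow_le_rpow (by positivity) ?_ hα.le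
    exact_mod_cast (by omega : k + N ≤ 2 * k)
  have h3 : 0 < ((k + N : ℕ) : ℝ) ^ α := by
    have : (0 : ℝ) < (k + N : ℕ) := by exact_mod_cast (by omega : 0 < k + N)
    positivity
  rw [div_le_div_iff₀ hk0 h3]
  have h4 : (k : ℝ) = (k : ℝ) ^ (1 - α) * (k : ℝ) ^ α := by
    rw [← Real.rpow_add hk0]; simp
  rw [div_le_iff₀ hc] at hk
  calc C * ((k + N : ℕ) : ℝ) ^ α ≤ |C| * (2 ^ α * (k : ℝ) ^ α) := by
        gcongr
        exact le_abs_self C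
    _ = |C| * 2 ^ α * (k : ℝ) ^ α := by ring
    _ ≤ ((k : ℝ) ^ (1 - α) * c) * (k : ℝ) ^ α := by gcongr
    _ = c * k := by conv_rhs => rw [h4]
                    ring

/-- A coordinate moves only along one residue class modulo `N`. The step sizes there still have
infinite sum, by comparison with `(j + 2)^(-α)` through `(j + 1) N + i ≤ (j + 2) N`. -/
theorem not_summable_div_rpow_arith {α c : ℝ} (hα : 0 < α) (hα' : α < 1) (hc : 0 < c) {N i : ℕ}
    (hi : i < N) : ¬ Summable fun j : ℕ => c / (((j + 1) * N + i : ℕ) : ℝ) ^ α := by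
  intro h
  have hN : (0 : ℝ) < N := by exact_mod_cast (by omega : 0 < N)
  have h1 : Summable fun j : ℕ => (((j + 2 : ℕ) : ℝ) ^ α)⁻¹ := by
    refine Summable.of_nonneg_of_le (fun j => by positivity) (fun j => ?_)
      (h.mul_left ((N : ℝ) ^ α / c))
    have hpos : (0 : ℝ) < (((j + 1) * N + i : ℕ) : ℝ) := by
      exact_mod_cast (by have : 0 < (j + 1) * N := by apply Nat.mul_pos <;> omega
                         omega)
    have hle : (((j + 1) * N + i : ℕ) : ℝ) ^ α ≤ ((j + 2 : ℕ) : ℝ) ^ α * (N : ℝ) ^ α := by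
      rw [← Real.mul_rpow (by positivity) hN.le]
      refine Real.rpow_le_rpow hpos.le ?_ hα.le
      exact_mod_cast (by nlinarith : (j + 1) * N + i ≤ (j + 2) * N)
    have h2 : (0 : ℝ) < (((j + 1) * N + i : ℕ) : ℝ) ^ α := by positivity
    have h3 : (0 : ℝ) < ((j + 2 : ℕ) : ℝ) ^ α := by positivity
    calc (((j + 2 : ℕ) : ℝ) ^ α)⁻¹ = (N : ℝ) ^ α / (((j + 2 : ℕ) : ℝ) ^ α * (N : ℝ) ^ α) := by
          field_simp
      _ ≤ (N : ℝ) ^ α / (((j + 1) * N + i : ℕ) : ℝ) ^ α := by gcongr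
      _ = _ := by field_simp
  have h2 := (summable_nat_add_iff (f := fun j : ℕ => ((j : ℝ) ^ α)⁻¹) 2).1 h1
  linarith [Real.summable_nat_rpow_inv.1 h2]

/-- Here `z` and `t` are the deviations of the remote and the local estimate. If the step towards
`t` does not carry `z` across zero, it reduces `|z|` by `s`; if it does, the new value lies within
`|t| + s` of zero. -/
theorem abs_add_sign_step_le {z t s slow shigh : ℝ} (hs0 : 0 ≤ slow) (hs : slow ≤ s)
    (hs' : s ≤ shigh) :
    |z + s * (if z < t then 1 else -1)| ≤ max (|z| - slow) (|t| + shigh) := by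
  rw [le_max_iff]
  by_contra! h
  obtain ⟨h1, h2⟩ := h
  split_ifs at h1 h2 with hz
  all_goals
    rcases abs_cases z with ⟨e1, _⟩ | ⟨e1, _⟩ <;> rcases abs_cases t with ⟨e2, _⟩ | ⟨e2, _⟩ <;>
    rw [e1] at h1 <;> rw [e2] at h2
  · rcases abs_cases (z + s * 1) with ⟨e3, _⟩ | ⟨e3, _⟩ <;> rw [e3] at h1 h2 <;> linarith
  · rcases abs_cases (z + s * 1) with ⟨e3, _⟩ | ⟨e3, _⟩ <;> rw [e3] at h1 h2 <;> linarith
  · rcases abs_cases (z + s * 1) with ⟨e3, _⟩ | ⟨e3, _⟩ <;> rw [e3] at h1 h2 <;> linarith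
  · rcases abs_cases (z + s * 1) with ⟨e3, _⟩ | ⟨e3, _⟩ <;> rw [e3] at h1 h2 <;> linarith
  · rcases abs_cases (z + s * -1) with ⟨e3, _⟩ | ⟨e3, _⟩ <;> rw [e3] at h1 h2 <;> linarith
  · rcases abs_cases (z + s * -1) with ⟨e3, _⟩ | ⟨e3, _⟩ <;> rw [e3] at h1 h2 <;> linarith
  · rcases abs_cases (z + s * -1) with ⟨e3, _⟩ | ⟨e3, _⟩ <;> rw [e3] at h1 h2 <;> linarith
  · rcases abs_cases (z + s * -1) with ⟨e3, _⟩ | ⟨e3, _⟩ <;> rw [e3] at h1 h2 <;> linarith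

theorem selector_dotProduct {N k : ℕ} {i : Fin N} (hi : (i : ℕ) = k % N) (v : Fin N → ℝ) :
    selector N k ⬝ᵥ v = v i := by
  rw [dotProduct, Finset.sum_eq_single i]
  · simp [selector, hi]
  · intro j _ hj
    have : (j : ℕ) ≠ k % N := fun h => hj (Fin.ext (h.trans hi.symm))
    simp [selector, this]
  · simp

theorem remoteEstimate_succ_apply_of_ne {N : ℕ} (α : ℝ) (β : ℕ → ℝ) (η₀ : Fin N → ℝ)
    (ϑ : ℕ → Fin N → ℝ) {k : ℕ} {i : Fin N} (hi : (i : ℕ) ≠ (k + 1) % N) :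
    remoteEstimate α β η₀ ϑ (k + 1) i = remoteEstimate α β η₀ ϑ k i := by
  simp [remoteEstimate, selector, hi]

theorem remoteEstimate_succ_apply_of_eq {N : ℕ} (α : ℝ) (β : ℕ → ℝ) (η₀ : Fin N → ℝ)
    (ϑ : ℕ → Fin N → ℝ) {k : ℕ} {i : Fin N} (hi : (i : ℕ) = (k + 1) % N) :
    remoteEstimate α β η₀ ϑ (k + 1) i = remoteEstimate α β η₀ ϑ k i
      + β (k + 1) / ((k + 1 : ℕ) : ℝ) ^ α
        * (if remoteEstimate α β η₀ ϑ k i < ϑ (k + 1) i then 1 else -1) := by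
  simp only [remoteEstimate, Pi.add_apply, Pi.smul_apply, smul_eq_mul, oneBit,
    selector_dotProduct hi]
  simp only [selector, hi, if_true, mul_one]
  ring

theorem remoteEstimate_sub_isBigO {N : ℕ} {α : ℝ} (hα : 1 / 2 < α) (hα' : α < 1)
    {β : ℕ → ℝ} {βlow βhigh : ℝ} (hβlow : 0 < βlow)
    (hβ : ∀ k, 1 ≤ k → βlow ≤ β k ∧ β k ≤ βhigh) (η₀ θ : Fin N → ℝ) {ϑ : ℕ → Fin N → ℝ}
    (hϑ : ∀ i, (fun k => ϑ k i - θ i) =O[atTop] fun k : ℕ => Real.sqrt (Real.log k / k))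
    (i : Fin N) :
    (fun k => remoteEstimate α β η₀ ϑ k i - θ i)
      =O[atTop] fun k : ℕ => Real.sqrt (Real.log k / k) := by
  have hiN := i.isLt
  have hα0 : 0 < α := by linarith
  set ρ : ℕ → ℝ := fun k => Real.sqrt (Real.log k / k) with hρ
  have hρ0 : ∀ k, 0 ≤ ρ k := fun k => Real.sqrt_nonneg _
  set z : ℕ → ℝ := fun k => remoteEstimate α β η₀ ϑ k i - θ i with hz
  -- The constant `C` fixes the tube: it absorbs the error of the target together with the largest
  -- overshoot.
  obtain ⟨C, hC0, hC⟩ : ∃ C > 0, ∀ᶠ k : ℕ in atTop,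
      |ϑ k i - θ i| + βhigh / (k : ℝ) ^ α ≤ C * ρ k := by
    have h1 : (fun k : ℕ => |ϑ k i - θ i| + βhigh * (1 / (k : ℝ) ^ α)) =O[atTop] ρ :=
      (hϑ i).abs_left.add ((inv_rpow_isBigO_sqrt_log_div hα).const_mul_left βhigh)
    obtain ⟨C, hC0, hC⟩ := h1.exists_pos
    refine ⟨C, hC0, hC.bound.mono fun k hk => ?_⟩
    rw [Real.norm_of_nonneg (hρ0 k)] at hk
    rw [div_eq_mul_one_div]
    exact (le_abs_self _).trans hk
  -- Coordinate `i` changes only at times congruent to `i` modulo `N`, so the error is constant on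
  -- the block of length `N` that starts at `j * N + i`. Sampling at block starts loses nothing.
  have hconst : ∀ j r, r < N → z (j * N + i + r) = z (j * N + i) := by
    intro j r
    induction r with
    | zero => simp
    | succ r ih =>
      intro hr
      rw [← ih (by omega), ← add_assoc]
      simp only [hz]
      rw [remoteEstimate_succ_apply_of_ne]
      intro h
      have h2 : (j * N + i + r + 1) % N = (i + r + 1) % N := by
        rw [show j * N + (i : ℕ) + r + 1 = (i + r + 1) + j * N by ring, Nat.add_mul_mod_self_right]
      rw [h2] at h
      rcases lt_or_ge ((i : ℕ) + r + 1) N with h3 | h3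
      · rw [Nat.mod_eq_of_lt h3] at h; omega
      · rw [Nat.mod_eq_sub_mod h3, Nat.mod_eq_of_lt (by omega)] at h; omega
  have htends : Tendsto (fun j : ℕ => j * N + (i : ℕ)) atTop atTop := by
    refine tendsto_atTop_mono (fun j => ?_) tendsto_id
    have : j * 1 ≤ j * N := Nat.mul_le_mul_left j (by omega)
    simp only [id]; omega
  have hmain : ∀ᶠ j : ℕ in atTop, |z (j * N + i)| ≤ C * ρ (j * N + i) := by
    refine eventually_abs_le_of_step (Z := fun j => z (j * N + i))
      (F := fun j => C * ρ (j * N + i))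
      (t := fun j : ℕ => βlow / (((j + 1) * N + i : ℕ) : ℝ) ^ α) (fun j => by positivity)
      (not_summable_div_rpow_arith hα0 hα' hβlow hiN) ?_ ?_
    · have hC' := ((tendsto_add_atTop_iff_nat 1).2 htends).eventually hC
      filter_upwards [hC'] with j hj
      have hidx : (j + 1) * N + (i : ℕ) = j * N + i + (N - 1) + 1 := by
        have : (j + 1) * N = j * N + N := by ring
        omega
      have hprev := hconst j (N - 1) (by omega)
      have hmod : (i : ℕ) = (j * N + i + (N - 1) + 1) % N := by
        rw [← hidx, add_comm, Nat.add_mul_mod_self_right, Nat.mod_eq_of_lt hiN]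
      refine le_trans ?_ (max_le_max_left _ hj)
      rw [← hprev]
      simp only [hz, hidx]
      rw [remoteEstimate_succ_apply_of_eq _ _ _ _ hmod]
      set K := j * N + (i : ℕ) + (N - 1)
      have hb := hβ (K + 1) (by omega)
      have hif : (remoteEstimate α β η₀ ϑ K i < ϑ (K + 1) i) ↔
          (remoteEstimate α β η₀ ϑ K i - θ i < ϑ (K + 1) i - θ i) := by
        constructor <;> intro h <;> linarith
      have hpos : (0 : ℝ) < ((K + 1 : ℕ) : ℝ) ^ α := by positivity
      have := abs_add_sign_step_le (z := remoteEstimate α β η₀ ϑ K i - θ i)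
        (t := ϑ (K + 1) i - θ i) (s := β (K + 1) / ((K + 1 : ℕ) : ℝ) ^ α)
        (slow := βlow / ((K + 1 : ℕ) : ℝ) ^ α) (shigh := βhigh / ((K + 1 : ℕ) : ℝ) ^ α)
        (by positivity) (div_le_div_of_nonneg_right hb.1 hpos.le)
        (div_le_div_of_nonneg_right hb.2 hpos.le)
      simp only [hif]
      rw [add_sub_right_comm]
      exact this
    -- Over one cycle the tube shrinks by at most `C * N / k`, which `α < 1` makes smaller than the
    -- guaranteed decrease `βlow / (k + N)^α`.
    · have h1 := htends.eventually (eventually_div_le_div_rpow_add hα0 hα' hβlow (C * N) N)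
      have h2 := htends.eventually (eventually_ge_atTop 1)
      filter_upwards [h1, h2] with j hj hj1
      have h3 := sqrt_log_div_le_add (N := N) hj1
      have hidx : j * N + (i : ℕ) + N = (j + 1) * N + i := by ring
      rw [hidx] at h3 hj
      have h4 := mul_le_mul_of_nonneg_left h3 hC0.le
      simp only [hρ]
      rw [mul_add, ← mul_div_assoc] at h4
      linarith
  -- A time `k` in the block starting at `A` satisfies `A ≤ k ≤ 2 * A`; passing from the width at
  -- `A` to the width at `k` costs the factor `√2`.
  refine IsBigO.of_bound (C * Real.sqrt 2) ?_
  obtain ⟨J, hJ⟩ := eventually_atTop.1 hmain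
  filter_upwards [eventually_ge_atTop ((J + 1) * N + N)] with k hk
  set j := (k - i) / N with hjdef
  have hdm := Nat.div_add_mod (k - i) N
  have hr := Nat.mod_lt (k - i) (by omega : 0 < N)
  have hmul : N * j = j * N := mul_comm _ _
  have hk' : k = j * N + i + (k - i) % N := by
    have : (i : ℕ) ≤ k := by nlinarith
    rw [← hjdef] at hdm
    omega
  have hj1 : J + 1 ≤ j := by
    rw [hjdef, Nat.le_div_iff_mul_le (by omega)]; omega
  have hle : N ≤ j * N := Nat.le_mul_of_pos_left N (by omega)
  set A := j * N + (i : ℕ) with hA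
  have hzk : z k = z A := by
    conv_lhs => rw [hk']
    exact hconst j _ hr
  rw [Real.norm_eq_abs, hzk, Real.norm_of_nonneg (hρ0 k)]
  refine (hJ j (by omega)).trans ?_
  rw [mul_assoc]
  refine mul_le_mul_of_nonneg_left ?_ hC0.le
  simp only [hρ]
  rw [← Real.sqrt_mul (by norm_num)]
  apply Real.sqrt_le_sqrt
  have hA0 : (0 : ℝ) < A := by exact_mod_cast (by omega : 0 < A)
  have hAk : (A : ℝ) ≤ k := by exact_mod_cast (by omega : A ≤ k)
  have hkA : (k : ℝ) ≤ 2 * A := by exact_mod_cast (by omega : k ≤ 2 * A)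
  have hl : Real.log A ≤ Real.log k := Real.log_le_log hA0 hAk
  have hl0 : 0 ≤ Real.log A := Real.log_natCast_nonneg A
  rw [← mul_div_assoc, div_le_div_iff₀ hA0 (by linarith)]
  nlinarith

/-! ### Recursive least squares in closed form -/

section RecursiveLeastSquares

variable {N : ℕ}

/-- The information matrix `P₀⁻¹ + ∑ φ φᵀ` of recursive least squares. -/
noncomputable def rlsInformation (P₀ : Matrix (Fin N) (Fin N) ℝ) (φ : ℕ → Fin N → ℝ) (k : ℕ) :
    Matrix (Fin N) (Fin N) ℝ :=
  P₀⁻¹ + ∑ l ∈ Finset.range k, vecMulVec (φ (l + 1)) (φ (l + 1))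

theorem rlsInformation_succ (P₀ : Matrix (Fin N) (Fin N) ℝ) (φ : ℕ → Fin N → ℝ) (k : ℕ) :
    rlsInformation P₀ φ (k + 1)
      = rlsInformation P₀ φ k + vecMulVec (φ (k + 1)) (φ (k + 1)) := by
  simp [rlsInformation, Finset.sum_range_succ, add_assoc]

theorem posDef_rlsInformation {P₀ : Matrix (Fin N) (Fin N) ℝ} (hP₀ : P₀.PosDef)
    (φ : ℕ → Fin N → ℝ) (k : ℕ) : (rlsInformation P₀ φ k).PosDef := by
  induction k with
  | zero => simpa [rlsInformation] using hP₀.inv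
  | succ k ih =>
    rw [rlsInformation_succ]
    refine ih.add_posSemidef ?_
    simpa using posSemidef_vecMulVec_self_star (φ (k + 1))

theorem rlsGain_mul_eq_one {P : Matrix (Fin N) (Fin N) ℝ} (hP : P.PosDef) (φ : Fin N → ℝ) :
    rlsGain P φ * (1 + φ ⬝ᵥ (P *ᵥ φ)) = 1 := by
  have h : 0 ≤ φ ⬝ᵥ (P *ᵥ φ) := by simpa using hP.posSemidef.dotProduct_mulVec_nonneg φ
  exact inv_mul_cancel₀ (by linarith)

/-- This is the Sherman–Morrison identity. The rank-one corrections combine to `1 - g (1 + vᵀ P v)`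
times `P v vᵀ`, and the gain `g` is chosen to make this scalar vanish. -/
theorem rlsCov_mul_rlsInformation {P₀ : Matrix (Fin N) (Fin N) ℝ} (hP₀ : P₀.PosDef)
    (φ : ℕ → Fin N → ℝ) (k : ℕ) : rlsCov P₀ φ k * rlsInformation P₀ φ k = 1 := by
  induction k with
  | zero => simpa [rlsCov, rlsInformation] using mul_nonsing_inv _ ((isUnit_iff_isUnit_det _).1 hP₀.isUnit)
  | succ k ih =>
    have hpos : (rlsCov P₀ φ k).PosDef := by
      rw [← inv_eq_left_inv ih]; exact (posDef_rlsInformation hP₀ φ k).inv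
    have hg := rlsGain_mul_eq_one hpos (φ (k + 1))
    rw [rlsInformation_succ, rlsCov]
    set P := rlsCov P₀ φ k
    set R := rlsInformation P₀ φ k
    set v := φ (k + 1)
    set g := rlsGain P v
    have h1 : P * vecMulVec v v * P * R = P * vecMulVec v v := by
      rw [Matrix.mul_assoc _ P R, ih, Matrix.mul_one]
    have h2 : P * vecMulVec v v * P * vecMulVec v v = (v ⬝ᵥ P *ᵥ v) • (P * vecMulVec v v) := by
      rw [Matrix.mul_assoc _ P, mul_vecMulVec, mul_vecMulVec, vecMulVec_mulVec]
      ext i j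
      simp [vecMulVec_apply]
      ring
    rw [Matrix.mul_add, Matrix.sub_mul, Matrix.sub_mul, Matrix.smul_mul, Matrix.smul_mul, h1, h2, ih,
      smul_smul]
    have h3 : (1 : Matrix (Fin N) (Fin N) ℝ) - g • (P * vecMulVec v v)
        + (P * vecMulVec v v - (g * (v ⬝ᵥ P *ᵥ v)) • (P * vecMulVec v v))
        = 1 + (1 - g * (1 + v ⬝ᵥ P *ᵥ v)) • (P * vecMulVec v v) := by
      rw [mul_add, mul_one, sub_smul, add_smul, one_smul]; abel
    rw [h3, hg]
    simp

/-- Multiplying the error by the information matrix linearizes the recursion: the gain cancels `1 +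
vᵀ P v`, the terms in `vᵀ ε` cancel, and each step adds just `w v`. -/
theorem rlsInformation_mulVec_error {P₀ : Matrix (Fin N) (Fin N) ℝ} (hP₀ : P₀.PosDef)
    {φ : ℕ → Fin N → ℝ} {y w : ℕ → ℝ} {θ : Fin N → ℝ}
    (hy : ∀ k, y (k + 1) = φ (k + 1) ⬝ᵥ θ + w (k + 1)) (ϑ₀ : Fin N → ℝ) (k : ℕ) :
    rlsInformation P₀ φ k *ᵥ (rlsEstimate P₀ ϑ₀ φ y k - θ)
      = P₀⁻¹ *ᵥ (ϑ₀ - θ) + ∑ l ∈ Finset.range k, w (l + 1) • φ (l + 1) := by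
  induction k with
  | zero => simp [rlsEstimate, rlsInformation]
  | succ k ih =>
    have hPR := rlsCov_mul_rlsInformation hP₀ φ k
    have hpos : (rlsCov P₀ φ k).PosDef := by
      rw [← inv_eq_left_inv hPR]; exact (posDef_rlsInformation hP₀ φ k).inv
    have hg := rlsGain_mul_eq_one hpos (φ (k + 1))
    rw [Finset.sum_range_succ, ← add_assoc, ← ih, rlsInformation_succ, rlsEstimate, hy]
    set P := rlsCov P₀ φ k
    set R := rlsInformation P₀ φ k
    set v := φ (k + 1)
    set g := rlsGain P v
    set ε := rlsEstimate P₀ ϑ₀ φ y k - θ with hε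
    have hRP : R * P = 1 := mul_eq_one_comm.1 hPR
    have h1 : v ⬝ᵥ θ + w (k + 1) - v ⬝ᵥ rlsEstimate P₀ ϑ₀ φ y k = w (k + 1) - v ⬝ᵥ ε := by
      rw [hε, dotProduct_sub]; ring
    rw [h1, add_sub_right_comm, ← hε, mulVec_add, add_mulVec, add_mulVec, mulVec_smul, mulVec_smul,
      mulVec_mulVec, hRP, one_mulVec, vecMulVec_mulVec, vecMulVec_mulVec]
    ext i
    simp only [Pi.add_apply, Pi.smul_apply, smul_eq_mul, MulOpposite.smul_eq_mul_unop,
      MulOpposite.unop_op]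
    linear_combination (w (k + 1) - v ⬝ᵥ ε) * v i * hg

/-- Under persistent excitation and a bound on the correlation of noise and regressors, the
least squares error has the rate `√(log k / k)`. -/
theorem rlsEstimate_sub_isBigO {P₀ : Matrix (Fin N) (Fin N) ℝ} (hP₀ : P₀.PosDef)
    {φ : ℕ → Fin N → ℝ} {y w : ℕ → ℝ} {θ : Fin N → ℝ}
    (hy : ∀ k, y (k + 1) = φ (k + 1) ⬝ᵥ θ + w (k + 1)) (ϑ₀ : Fin N → ℝ)
    {M : Matrix (Fin N) (Fin N) ℝ} (hM : M.PosDef)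
    (hφ : ∀ i j, Tendsto (fun k : ℕ => (∑ l ∈ Finset.range k, φ (l + 1) i * φ (l + 1) j) / k) atTop
      (𝓝 (M i j)))
    (hw : ∀ i, (fun k : ℕ => (∑ l ∈ Finset.range k, φ (l + 1) i * w (l + 1)) / k)
      =O[atTop] fun k : ℕ => Real.sqrt (Real.log k / k)) (i : Fin N) :
    (fun k => rlsEstimate P₀ ϑ₀ φ y k i - θ i)
      =O[atTop] fun k : ℕ => Real.sqrt (Real.log k / k) := by
  have hinv : Tendsto (fun k : ℕ => 1 / (k : ℝ)) atTop (𝓝 0) := tendsto_one_div_atTop_nhds_zero_nat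
  set B : ℕ → Matrix (Fin N) (Fin N) ℝ := fun k => (1 / (k : ℝ)) • rlsInformation P₀ φ k with hB
  have hBM : Tendsto B atTop (𝓝 M) := by
    refine tendsto_pi_nhds.2 fun a => tendsto_pi_nhds.2 fun c => ?_
    have h : ∀ k, B k a c = 1 / (k : ℝ) * P₀⁻¹ a c
        + (∑ l ∈ Finset.range k, φ (l + 1) a * φ (l + 1) c) / k := by
      intro k
      simp only [hB, rlsInformation, Matrix.smul_apply, Matrix.add_apply, Matrix.sum_apply, vecMulVec_apply, smul_eq_mul]
      ring
    simp_rw [h]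
    simpa using (hinv.mul_const (P₀⁻¹ a c)).add (hφ a c)
  have hdet : M.det ≠ 0 := hM.det_pos.ne'
  -- The limit has nonzero determinant, so the inverses converge through the formula with the
  -- adjugate; their entries are therefore bounded.
  have hBinv : Tendsto (fun k => (B k)⁻¹) atTop (𝓝 M⁻¹) := by
    simp_rw [inv_def, Ring.inverse_eq_inv']
    have h1 : Tendsto (fun k => (B k).det) atTop (𝓝 M.det) :=
      ((continuous_id.matrix_det).tendsto M).comp hBM
    have h2 : Tendsto (fun k => (B k).adjugate) atTop (𝓝 M.adjugate) :=
      ((continuous_id.matrix_adjugate).tendsto M).comp hBM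
    exact (h1.inv₀ hdet).smul h2
  have hk : (fun k : ℕ => 1 / (k : ℝ)) =O[atTop] fun k : ℕ => Real.sqrt (Real.log k / k) := by
    simpa using inv_rpow_isBigO_sqrt_log_div (α := 1) (by norm_num)
  have hsum : (fun k : ℕ => ∑ j, (B k)⁻¹ i j * (1 / (k : ℝ) * (P₀⁻¹ *ᵥ (ϑ₀ - θ)) j
      + (∑ l ∈ Finset.range k, φ (l + 1) j * w (l + 1)) / k))
      =O[atTop] fun k : ℕ => Real.sqrt (Real.log k / k) := by
    refine IsBigO.fun_sum fun j _ => ?_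
    have h1 : (fun k => (B k)⁻¹ i j) =O[atTop] fun _ => (1 : ℝ) :=
      ((tendsto_pi_nhds.1 (tendsto_pi_nhds.1 hBinv i)) j).isBigO_one ℝ
    have h2 := (hk.const_mul_left ((P₀⁻¹ *ᵥ (ϑ₀ - θ)) j)).add (hw j)
    simpa [mul_comm] using h1.mul h2
  refine hsum.congr' ?_ EventuallyEq.rfl
  filter_upwards [eventually_ge_atTop 1] with k hk1
  have hk0 : (k : ℝ) ≠ 0 := by positivity
  have hPR := rlsCov_mul_rlsInformation hP₀ φ k
  have hBi : (B k)⁻¹ = (k : ℝ) • rlsCov P₀ φ k := by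
    apply inv_eq_left_inv
    rw [hB, Matrix.smul_mul, Matrix.mul_smul, hPR, smul_smul, mul_one_div_cancel hk0, one_smul]
  have herr : rlsEstimate P₀ ϑ₀ φ y k - θ = rlsCov P₀ φ k *ᵥ
      (P₀⁻¹ *ᵥ (ϑ₀ - θ) + ∑ l ∈ Finset.range k, w (l + 1) • φ (l + 1)) := by
    rw [← rlsInformation_mulVec_error hP₀ hy ϑ₀ k, mulVec_mulVec, hPR, one_mulVec]
  rw [← Pi.sub_apply, herr, hBi, mulVec, dotProduct]
  refine Finset.sum_congr rfl fun j _ => ?_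
  simp only [Matrix.smul_apply, smul_eq_mul, Pi.add_apply, Finset.sum_apply, Pi.smul_apply]
  simp_rw [mul_comm (w _)]
  field_simp

end RecursiveLeastSquares

/-! ### Sums of regressors times Gaussian noise -/

section Noise

open scoped ENNReal NNReal

variable {Ω : Type*} {mΩ : MeasurableSpace Ω} {μ : Measure Ω}

/-- Borel–Cantelli in the form used twice below: a finite total expectation makes the series finite
almost everywhere, so its terms vanish in the limit. -/
theorem ae_tendsto_zero_of_tsum_lintegral_ne_top {f : ℕ → Ω → ℝ≥0∞} (hf : ∀ k, Measurable (f k))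
    (h : ∑' k, ∫⁻ ω, f k ω ∂μ ≠ ∞) : ∀ᵐ ω ∂μ, Tendsto (fun k => f k ω) atTop (𝓝 0) := by
  rw [← lintegral_tsum fun k => (hf k).aemeasurable] at h
  filter_upwards [ae_lt_top (Measurable.tsum hf) h] with ω hω
  exact ENNReal.tendsto_atTop_zero_of_tsum_ne_top hω.ne

theorem lintegral_exp_gaussianReal (v : ℝ≥0) (t : ℝ) :
    ∫⁻ x, ENNReal.ofReal (Real.exp (t * x - v * t ^ 2 / 2)) ∂(gaussianReal 0 v) = 1 := by
  have hint : Integrable (fun x => Real.exp (t * x - v * t ^ 2 / 2)) (gaussianReal 0 v) := by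
    simp_rw [sub_eq_add_neg, Real.exp_add]
    exact (integrable_exp_mul_gaussianReal t).mul_const _
  rw [← ofReal_integral_eq_lintegral_ofReal hint (ae_of_all _ fun x => (Real.exp_pos _).le)]
  simp_rw [sub_eq_add_neg, Real.exp_add]
  rw [integral_mul_const]
  have h := congrFun (mgf_id_gaussianReal (μ := 0) (v := v)) t
  rw [mgf] at h
  simp only [id] at h
  rw [h, ← Real.exp_add]
  simp

/-- One martingale step. By independence the joint law is a product, so `d` can be integrated first
with `x` fixed, and the normalized Gaussian exponential integrates to one. Lower integrals avoid any
integrability condition on `x`. -/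
theorem lintegral_mul_exp_of_indep [IsProbabilityMeasure μ] {G : Ω → ℝ≥0∞} {x d : Ω → ℝ} {v : ℝ≥0}
    (hG : Measurable G) (hx : Measurable x) (hd : Measurable d)
    (hind : IndepFun (fun ω => (G ω, x ω)) d μ) (hlaw : μ.map d = gaussianReal 0 v) (c : ℝ) :
    ∫⁻ ω, G ω * ENNReal.ofReal (Real.exp (c * x ω * d ω - v * (c * x ω) ^ 2 / 2)) ∂μ
      = ∫⁻ ω, G ω ∂μ := by
  have hGx : Measurable fun ω => (G ω, x ω) := hG.prodMk hx
  have hmap := (indepFun_iff_map_prod_eq_prod_map_map hGx.aemeasurable hd.aemeasurable).1 hind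
  have hmeas : Measurable fun p : (ℝ≥0∞ × ℝ) × ℝ =>
      p.1.1 * ENNReal.ofReal (Real.exp (c * p.1.2 * p.2 - v * (c * p.1.2) ^ 2 / 2)) := by
    fun_prop
  have hprod : Measurable fun ω => ((G ω, x ω), d ω) := hGx.prodMk hd
  calc ∫⁻ ω, G ω * ENNReal.ofReal (Real.exp (c * x ω * d ω - v * (c * x ω) ^ 2 / 2)) ∂μ
      = ∫⁻ p, p.1.1 * ENNReal.ofReal (Real.exp (c * p.1.2 * p.2 - v * (c * p.1.2) ^ 2 / 2))
          ∂(μ.map fun ω => ((G ω, x ω), d ω)) := (lintegral_map hmeas hprod).symm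
    _ = ∫⁻ q, q.1 ∂(μ.map fun ω => (G ω, x ω)) := by
        have : IsProbabilityMeasure (μ.map fun ω => (G ω, x ω)) :=
          Measure.isProbabilityMeasure_map hGx.aemeasurable
        rw [hmap, hlaw, lintegral_prod _ hmeas.aemeasurable]
        refine lintegral_congr fun q => ?_
        dsimp only
        rw [lintegral_const_mul _ (by fun_prop), lintegral_exp_gaussianReal, mul_one]
    _ = ∫⁻ ω, G ω ∂μ := lintegral_map measurable_fst hGx

/-- The exponential martingale of a Gaussian martingale transform has total mass one. -/
theorem lintegral_exp_sum_eq_one [IsProbabilityMeasure μ] {F : ℕ → MeasurableSpace Ω}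
    (hF : ∀ k, F k ≤ mΩ) (hmono : ∀ k, F k ≤ F (k + 1)) {x d : ℕ → Ω → ℝ} {v : ℝ≥0}
    (hx : ∀ k, Measurable[F k] (x k)) (hd : ∀ k, Measurable[F (k + 1)] (d k))
    (hind : ∀ k, Indep (F k) (MeasurableSpace.comap (d k) inferInstance) μ)
    (hlaw : ∀ k, μ.map (d k) = gaussianReal 0 v) (c : ℝ) (k : ℕ) :
    ∫⁻ ω, ENNReal.ofReal (Real.exp (∑ l ∈ Finset.range k,
      (c * x l ω * d l ω - v * (c * x l ω) ^ 2 / 2))) ∂μ = 1 := by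
  have hFmono : Monotone F := monotone_nat_of_le_succ hmono
  induction k with
  | zero => simp
  | succ k ih =>
    simp_rw [Finset.sum_range_succ, Real.exp_add, ENNReal.ofReal_mul (Real.exp_pos _).le]
    have hG : Measurable[F k] fun ω => ENNReal.ofReal (Real.exp (∑ l ∈ Finset.range k,
        (c * x l ω * d l ω - v * (c * x l ω) ^ 2 / 2))) := by
      refine ENNReal.measurable_ofReal.comp (Real.measurable_exp.comp ?_)
      refine Finset.measurable_fun_sum _ fun l hl => ?_
      have hl' := Finset.mem_range.1 hl
      have hxl : Measurable[F k] (x l) := (hx l).mono (hFmono hl'.le) le_rfl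
      have hdl : Measurable[F k] (d l) := (hd l).mono (hFmono hl') le_rfl
      exact ((hxl.const_mul c).mul hdl).sub (((hxl.const_mul c).pow_const 2).const_mul _ |>.div_const _)
    rw [lintegral_mul_exp_of_indep (hG.mono (hF k) le_rfl) ((hx k).mono (hF k) le_rfl)
      ((hd k).mono (hF _) le_rfl) ?_ (hlaw k), ih]
    exact indep_of_indep_of_le_left (hind k)
      (Measurable.comap_le (hG.prodMk (hx k)))

/-- Each horizon `k` has its own parameter `c k`, since only the mean of the exponential at time `k`
is used. Weighted by `k⁻²` these means are summable, so the exponent is eventually below `2 log k`.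
-/
theorem ae_eventually_sum_le_of_sq [IsProbabilityMeasure μ] {F : ℕ → MeasurableSpace Ω}
    (hF : ∀ k, F k ≤ mΩ) (hmono : ∀ k, F k ≤ F (k + 1)) {x d : ℕ → Ω → ℝ} {v : ℝ≥0}
    (hx : ∀ k, Measurable[F k] (x k)) (hd : ∀ k, Measurable[F (k + 1)] (d k))
    (hind : ∀ k, Indep (F k) (MeasurableSpace.comap (d k) inferInstance) μ)
    (hlaw : ∀ k, μ.map (d k) = gaussianReal 0 v) (c : ℕ → ℝ) :
    ∀ᵐ ω ∂μ, ∀ᶠ k : ℕ in atTop, c k * ∑ l ∈ Finset.range k, x l ω * d l ω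
      ≤ v * c k ^ 2 / 2 * ∑ l ∈ Finset.range k, x l ω ^ 2 + 2 * Real.log k := by
  have hmeas : ∀ k, Measurable fun ω => ENNReal.ofReal (Real.exp (∑ l ∈ Finset.range k,
      (c k * x l ω * d l ω - v * (c k * x l ω) ^ 2 / 2))) := by
    intro k
    have h1 : ∀ l, Measurable (x l) := fun l => (hx l).mono (hF l) le_rfl
    have h2 : ∀ l, Measurable (d l) := fun l => (hd l).mono (hF _) le_rfl
    fun_prop
  have hsum : ∑' k : ℕ, ∫⁻ ω, ENNReal.ofReal (1 / (k : ℝ) ^ 2) *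
      ENNReal.ofReal (Real.exp (∑ l ∈ Finset.range k,
      (c k * x l ω * d l ω - v * (c k * x l ω) ^ 2 / 2))) ∂μ ≠ ∞ := by
    have h : ∀ k : ℕ, ∫⁻ ω, ENNReal.ofReal (1 / (k : ℝ) ^ 2) *
        ENNReal.ofReal (Real.exp (∑ l ∈ Finset.range k,
        (c k * x l ω * d l ω - v * (c k * x l ω) ^ 2 / 2))) ∂μ
        = ENNReal.ofReal (1 / (k : ℝ) ^ 2) := by
      intro k
      rw [lintegral_const_mul _ (hmeas k), lintegral_exp_sum_eq_one hF hmono hx hd hind hlaw, mul_one]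
    simp_rw [h]
    rw [← ENNReal.ofReal_tsum_of_nonneg (fun k => by positivity)
      (Real.summable_one_div_nat_pow.2 one_lt_two)]
    exact ENNReal.ofReal_ne_top
  filter_upwards [ae_tendsto_zero_of_tsum_lintegral_ne_top
    (fun k => (hmeas k).const_mul _) hsum] with ω hω
  have h1 := hω.eventually (gt_mem_nhds (zero_lt_one))
  filter_upwards [h1, eventually_ge_atTop 1] with k hk hk1
  have hk0 : (0 : ℝ) < k := by exact_mod_cast hk1
  rw [← ENNReal.ofReal_mul (by positivity), ENNReal.ofReal_lt_one, one_div, inv_mul_lt_iff₀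
    (by positivity), mul_one] at hk
  have h2 := (Real.lt_log_iff_exp_lt (by positivity)).2 hk
  rw [Real.log_pow, Finset.sum_sub_distrib] at h2
  rw [Finset.mul_sum, Finset.mul_sum]
  have h3 : ∑ l ∈ Finset.range k, c k * x l ω * d l ω
      = ∑ l ∈ Finset.range k, c k * (x l ω * d l ω) :=
    Finset.sum_congr rfl fun l _ => by ring
  have h4 : ∑ l ∈ Finset.range k, (v : ℝ) * (c k * x l ω) ^ 2 / 2
      = ∑ l ∈ Finset.range k, v * c k ^ 2 / 2 * x l ω ^ 2 :=
    Finset.sum_congr rfl fun l _ => by ring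
  rw [h3, h4] at h2
  push_cast at h2
  linarith

/-- A Gaussian martingale transform grows at most like `√(k log k)` when the sum of the squared
weights grows at most linearly. -/
theorem ae_sum_mul_div_isBigO [IsProbabilityMeasure μ] {F : ℕ → MeasurableSpace Ω}
    (hF : ∀ k, F k ≤ mΩ) (hmono : ∀ k, F k ≤ F (k + 1)) {x d : ℕ → Ω → ℝ} {v : ℝ≥0}
    (hx : ∀ k, Measurable[F k] (x k)) (hd : ∀ k, Measurable[F (k + 1)] (d k))
    (hind : ∀ k, Indep (F k) (MeasurableSpace.comap (d k) inferInstance) μ)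
    (hlaw : ∀ k, μ.map (d k) = gaussianReal 0 v) {q : ℝ}
    (hq : ∀ᵐ ω ∂μ, Tendsto (fun k : ℕ => (∑ l ∈ Finset.range k, x l ω ^ 2) / k) atTop (𝓝 q)) :
    ∀ᵐ ω ∂μ, (fun k : ℕ => (∑ l ∈ Finset.range k, x l ω * d l ω) / k)
      =O[atTop] fun k : ℕ => Real.sqrt (Real.log k / k) := by
  -- The choice `c k = ±√(log k / k)` makes `c² k` equal to `log k`, balancing the two terms of the
  -- bound; the two signs give both tails.
  have hpos := ae_eventually_sum_le_of_sq hF hmono hx hd hind hlaw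
    fun k : ℕ => Real.sqrt (Real.log k / k)
  have hneg := ae_eventually_sum_le_of_sq hF hmono hx hd hind hlaw
    fun k : ℕ => -Real.sqrt (Real.log k / k)
  filter_upwards [hpos, hneg, hq] with ω h1 h2 h3
  refine IsBigO.of_bound (v / 2 * (q + 1) + 2) ?_
  filter_upwards [h1, h2, h3.eventually (gt_mem_nhds (lt_add_one q)), eventually_ge_atTop 2]
    with k hk1 hk2 hk3 hk
  have hk0 : (0 : ℝ) < k := by exact_mod_cast (by omega : 0 < k)
  have hlog : 0 < Real.log k := Real.log_pos (by exact_mod_cast (by omega : 1 < k))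
  set ρ := Real.sqrt (Real.log k / k) with hρ
  have hρ0 : 0 < ρ := Real.sqrt_pos.2 (by positivity)
  have hρ2 : ρ ^ 2 = Real.log k / k := Real.sq_sqrt (by positivity)
  set S := ∑ l ∈ Finset.range k, x l ω * d l ω
  set Q := ∑ l ∈ Finset.range k, x l ω ^ 2
  have hlogk : Real.log k = ρ ^ 2 * k := by rw [hρ2]; field_simp
  rw [div_lt_iff₀ hk0] at hk3
  have hv : (0 : ℝ) ≤ v := v.2
  have hQ : v * ρ ^ 2 / 2 * Q ≤ v * ρ ^ 2 / 2 * ((q + 1) * k) :=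
    mul_le_mul_of_nonneg_left hk3.le (by positivity)
  rw [neg_sq] at hk2
  rw [hlogk] at hk1 hk2
  have hS : |S| ≤ (v / 2 * (q + 1) + 2) * ρ * k := by
    rw [abs_le]
    constructor
    · have : ρ * -S ≤ ρ * ((v / 2 * (q + 1) + 2) * ρ * k) := by nlinarith
      linarith [le_of_mul_le_mul_left this hρ0]
    · have : ρ * S ≤ ρ * ((v / 2 * (q + 1) + 2) * ρ * k) := by nlinarith
      exact le_of_mul_le_mul_left this hρ0
  rw [Real.norm_eq_abs, abs_div, abs_of_pos hk0, Real.norm_of_nonneg hρ0.le, div_le_iff₀ hk0]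
  exact hS

end Noise

/-! ### Quadratic forms in independent variables -/

section Innovations

variable {Ω : Type*} [MeasurableSpace Ω] {μ : Measure Ω}

theorem integral_sq_sum_eq {ι : Type*} (s : Finset ι) (q : ι → ℝ) {ψ : ι → Ω → ℝ}
    (hψ : ∀ p, MemLp (ψ p) 2 μ) :
    ∫ ω, (∑ p ∈ s, q p * ψ p ω) ^ 2 ∂μ
      = ∑ p ∈ s, ∑ p' ∈ s, q p * q p' * ∫ ω, ψ p ω * ψ p' ω ∂μ := by
  have hint : ∀ p p', Integrable (fun ω => q p * q p' * (ψ p ω * ψ p' ω)) μ := fun p p' =>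
    ((hψ p).integrable_mul (hψ p')).const_mul _
  have h : ∀ ω, (∑ p ∈ s, q p * ψ p ω) ^ 2
      = ∑ p ∈ s, ∑ p' ∈ s, q p * q p' * (ψ p ω * ψ p' ω) := by
    intro ω
    rw [sq, Finset.sum_mul_sum]
    exact Finset.sum_congr rfl fun p _ => Finset.sum_congr rfl fun p' _ => by ring
  simp_rw [h]
  rw [integral_finsetSum _ fun p _ => integrable_finsetSum _ fun p' _ => hint p p']
  refine Finset.sum_congr rfl fun p _ => ?_
  rw [integral_finsetSum _ fun p' _ => hint p p']
  exact Finset.sum_congr rfl fun p' _ => integral_const_mul _ _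

/-- Independent centred variables with common variance `σ2` and fourth moments at most `κ`. -/
structure IsInnovation (μ : Measure Ω) (e : ℕ → Ω → ℝ) (σ2 κ : ℝ) : Prop where
  measurable : ∀ k, Measurable (e k)
  indep : iIndepFun e μ
  mean : ∀ k, ∫ ω, e k ω ∂μ = 0
  secondMoment : ∀ k, ∫ ω, e k ω ^ 2 ∂μ = σ2
  integrable_fourth : ∀ k, Integrable (fun ω => e k ω ^ 4) μ
  fourthMoment : ∀ k, ∫ ω, e k ω ^ 4 ∂μ ≤ κ

namespace IsInnovation

variable {e : ℕ → Ω → ℝ} {σ2 κ : ℝ}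

theorem sigma_nonneg (he : IsInnovation μ e σ2 κ) : 0 ≤ σ2 := by
  rw [← he.secondMoment 0]; exact integral_nonneg fun ω => sq_nonneg _

theorem kappa_nonneg (he : IsInnovation μ e σ2 κ) : 0 ≤ κ :=
  (integral_nonneg fun ω => by positivity).trans (he.fourthMoment 0)

theorem memLp_two [IsFiniteMeasure μ] (he : IsInnovation μ e σ2 κ) (k : ℕ) : MemLp (e k) 2 μ := by
  rw [memLp_two_iff_integrable_sq (he.measurable k).aestronglyMeasurable]
  refine ((integrable_const (1 : ℝ)).add (he.integrable_fourth k)).mono'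
    ((he.measurable k).pow_const 2).aestronglyMeasurable (ae_of_all _ fun ω => ?_)
  rw [Real.norm_of_nonneg (sq_nonneg _)]
  simp only [Pi.add_apply]
  nlinarith [sq_nonneg (e k ω ^ 2 - 1)]

theorem memLp_mul (he : IsInnovation μ e σ2 κ) (i j : ℕ) :
    MemLp (fun ω => e i ω * e j ω) 2 μ := by
  have hm : Measurable fun ω => e i ω * e j ω := (he.measurable i).mul (he.measurable j)
  rw [memLp_two_iff_integrable_sq hm.aestronglyMeasurable]
  refine ((he.integrable_fourth i).add (he.integrable_fourth j)).mono'
    (hm.pow_const 2).aestronglyMeasurable (ae_of_all _ fun ω => ?_)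
  rw [Real.norm_of_nonneg (sq_nonneg _)]
  simp only [Pi.add_apply]
  nlinarith [sq_nonneg (e i ω ^ 2 - e j ω ^ 2), sq_nonneg (e i ω ^ 2), sq_nonneg (e j ω ^ 2)]

theorem integral_mul_of_ne (he : IsInnovation μ e σ2 κ) {i j : ℕ} (hij : i ≠ j) :
    ∫ ω, e i ω * e j ω ∂μ = 0 := by
  rw [(he.indep.indepFun hij).integral_fun_mul_eq_mul_integral
    (he.measurable i).aestronglyMeasurable (he.measurable j).aestronglyMeasurable, he.mean, zero_mul]

theorem integral_sq_linear [IsFiniteMeasure μ] (he : IsInnovation μ e σ2 κ) (s : Finset ℕ)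
    (b : ℕ → ℝ) : ∫ ω, (∑ j ∈ s, b j * e j ω) ^ 2 ∂μ = σ2 * ∑ j ∈ s, b j ^ 2 := by
  rw [integral_sq_sum_eq s b he.memLp_two, Finset.mul_sum]
  refine Finset.sum_congr rfl fun j hj => ?_
  rw [Finset.sum_eq_single j]
  · simp_rw [← sq]
    rw [he.secondMoment]; ring
  · intro i _ hi
    rw [he.integral_mul_of_ne hi.symm, mul_zero]
  · exact fun h => absurd hj h

/-- A product with a factor of an index that occurs only once has mean zero. -/
theorem integral_mul_isolated (he : IsInnovation μ e σ2 κ) {a b c d : ℕ} (ha : a ≠ d)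
    (hb : b ≠ d) (hc : c ≠ d) : ∫ ω, (e a ω * e b ω * e c ω) * e d ω ∂μ = 0 := by
  have h := he.indep.indepFun_finset {a, b, c} {d}
    (by simp [Finset.disjoint_singleton_right, ha.symm, hb.symm, hc.symm]) he.measurable
  have hψ : Measurable fun v : ({d} : Finset ℕ) → ℝ => v ⟨d, by simp⟩ := measurable_pi_apply _
  have hcomp := h.comp
    (φ := fun v : ({a, b, c} : Finset ℕ) → ℝ =>
      v ⟨a, by simp⟩ * v ⟨b, by simp⟩ * v ⟨c, by simp⟩)
    (by fun_prop) hψ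
  have hm : Measurable fun ω => e a ω * e b ω * e c ω :=
    ((he.measurable a).mul (he.measurable b)).mul (he.measurable c)
  have h2 := IndepFun.integral_fun_mul_eq_mul_integral hcomp hm.aestronglyMeasurable
    (he.measurable d).aestronglyMeasurable
  simp only [Function.comp_def] at h2
  rw [h2, he.mean, mul_zero]

/-- The unordered pairs `{a, b}` and `{c, d}` differ. Either some index occurs exactly once and both
sides vanish, or `a = b`, `c = d`, `a ≠ c`, and the two squares are independent. -/
theorem integral_mul_mul_eq (he : IsInnovation μ e σ2 κ) {a b c d : ℕ}
    (h1 : ¬ (c = a ∧ d = b)) (h2 : ¬ (c = b ∧ d = a)) :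
    ∫ ω, (e a ω * e b ω) * (e c ω * e d ω) ∂μ
      = (∫ ω, e a ω * e b ω ∂μ) * ∫ ω, e c ω * e d ω ∂μ := by
  by_cases hcd : c = d
  · subst hcd
    by_cases hab : a = b
    · subst hab
      have hac : a ≠ c := fun h => h1 ⟨h.symm, h.symm⟩
      have := (he.indep.indepFun hac).comp (φ := fun t => t * t) (ψ := fun t => t * t)
        (by fun_prop) (by fun_prop)
      exact IndepFun.integral_fun_mul_eq_mul_integral this
        ((he.measurable a).mul (he.measurable a)).aestronglyMeasurable
        ((he.measurable c).mul (he.measurable c)).aestronglyMeasurable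
    · rw [he.integral_mul_of_ne hab, zero_mul]
      by_cases hca : a = c
      · rw [← he.integral_mul_isolated (a := a) (b := c) (c := c) (d := b) hab (by omega) (by omega)]
        exact integral_congr_ae (ae_of_all _ fun ω => by ring)
      · rw [← he.integral_mul_isolated (a := b) (b := c) (c := c) (d := a) (by omega) (by omega)
          (by omega)]
        exact integral_congr_ae (ae_of_all _ fun ω => by ring)
  · rw [he.integral_mul_of_ne hcd, mul_zero]
    by_cases hd : a ≠ d ∧ b ≠ d
    · rw [← he.integral_mul_isolated (a := a) (b := b) (c := c) (d := d) hd.1 hd.2 hcd]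
      exact integral_congr_ae (ae_of_all _ fun ω => by ring)
    · have hca : a ≠ c ∧ b ≠ c := by omega
      rw [← he.integral_mul_isolated (a := a) (b := b) (c := d) (d := c) hca.1 hca.2 (Ne.symm hcd)]
      exact integral_congr_ae (ae_of_all _ fun ω => by ring)

/-- The centred product of two innovations. -/
noncomputable def centredMul (μ : Measure Ω) (e : ℕ → Ω → ℝ) (p : ℕ × ℕ) (ω : Ω) : ℝ :=
  e p.1 ω * e p.2 ω - ∫ ω', e p.1 ω' * e p.2 ω' ∂μ

theorem memLp_centredMul [IsFiniteMeasure μ] (he : IsInnovation μ e σ2 κ) (p : ℕ × ℕ) :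
    MemLp (centredMul μ e p) 2 μ :=
  (he.memLp_mul p.1 p.2).sub (memLp_const _)

variable [IsProbabilityMeasure μ]

theorem integral_centredMul_mul (he : IsInnovation μ e σ2 κ) (p p' : ℕ × ℕ) :
    ∫ ω, centredMul μ e p ω * centredMul μ e p' ω ∂μ
      = ∫ ω, (e p.1 ω * e p.2 ω) * (e p'.1 ω * e p'.2 ω) ∂μ
        - (∫ ω, e p.1 ω * e p.2 ω ∂μ) * ∫ ω, e p'.1 ω * e p'.2 ω ∂μ := by
  have hp := he.memLp_mul p.1 p.2
  have hp' := he.memLp_mul p'.1 p'.2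
  set m := ∫ ω, e p.1 ω * e p.2 ω ∂μ with hm
  set m' := ∫ ω, e p'.1 ω * e p'.2 ω ∂μ with hm'
  have h : ∀ ω, centredMul μ e p ω * centredMul μ e p' ω
      = (e p.1 ω * e p.2 ω) * (e p'.1 ω * e p'.2 ω)
        - (m' * (e p.1 ω * e p.2 ω) + m * (e p'.1 ω * e p'.2 ω) - m * m') := by
    intro ω
    simp only [centredMul, ← hm, ← hm']
    ring
  simp_rw [h]
  have i1 := (hp.integrable one_le_two).const_mul m'
  have i2 := (hp'.integrable one_le_two).const_mul m
  have i0 : Integrable (fun ω => (e p.1 ω * e p.2 ω) * (e p'.1 ω * e p'.2 ω)) μ :=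
    hp.integrable_mul hp'
  have i12 : Integrable (fun ω => m' * (e p.1 ω * e p.2 ω) + m * (e p'.1 ω * e p'.2 ω)) μ :=
    i1.add i2
  have i3 : Integrable
      (fun ω => m' * (e p.1 ω * e p.2 ω) + m * (e p'.1 ω * e p'.2 ω) - m * m') μ :=
    i12.sub (integrable_const _)
  rw [integral_sub i0 i3, integral_sub i12 (integrable_const _), integral_add i1 i2, integral_const_mul,
    integral_const_mul, ← hm, ← hm']
  simp
  ring

theorem integral_centredMul_sq_le (he : IsInnovation μ e σ2 κ) (p : ℕ × ℕ) :
    ∫ ω, centredMul μ e p ω ^ 2 ∂μ ≤ κ := by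
  have h1 : ∫ ω, (e p.1 ω * e p.2 ω) * (e p.1 ω * e p.2 ω) ∂μ ≤ κ := by
    have hi := he.integrable_fourth p.1
    have hj := he.integrable_fourth p.2
    calc ∫ ω, (e p.1 ω * e p.2 ω) * (e p.1 ω * e p.2 ω) ∂μ
        ≤ ∫ ω, (1 / 2 * e p.1 ω ^ 4 + 1 / 2 * e p.2 ω ^ 4) ∂μ := by
          refine integral_mono ((he.memLp_mul p.1 p.2).integrable_mul (he.memLp_mul p.1 p.2))
            ((hi.const_mul _).add (hj.const_mul _)) fun ω => ?_
          dsimp only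
          nlinarith [sq_nonneg (e p.1 ω ^ 2 - e p.2 ω ^ 2)]
      _ = 1 / 2 * ∫ ω, e p.1 ω ^ 4 ∂μ + 1 / 2 * ∫ ω, e p.2 ω ^ 4 ∂μ := by
          rw [integral_add (hi.const_mul _) (hj.const_mul _), integral_const_mul, integral_const_mul]
      _ ≤ κ := by linarith [he.fourthMoment p.1, he.fourthMoment p.2]
  simp_rw [sq]
  rw [he.integral_centredMul_mul p p]
  nlinarith [mul_self_nonneg (∫ ω, e p.1 ω * e p.2 ω ∂μ)]

/-- The covariance matrix of the products is sparse: a pair is correlated only with itself and its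
transpose. -/
theorem abs_integral_centredMul_mul_le (he : IsInnovation μ e σ2 κ) (p p' : ℕ × ℕ) :
    |∫ ω, centredMul μ e p ω * centredMul μ e p' ω ∂μ|
      ≤ κ * ((if p' = p then 1 else 0) + if p' = p.swap then 1 else 0) := by
  have hκ := he.kappa_nonneg
  by_cases h : p' = p ∨ p' = p.swap
  · have hle : |∫ ω, centredMul μ e p ω * centredMul μ e p' ω ∂μ| ≤ κ := by
      have i1 := (he.memLp_centredMul p).integrable_sq.const_mul (1 / 2)
      have i2 := (he.memLp_centredMul p').integrable_sq.const_mul (1 / 2)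
      calc |∫ ω, centredMul μ e p ω * centredMul μ e p' ω ∂μ|
          ≤ ∫ ω, |centredMul μ e p ω * centredMul μ e p' ω| ∂μ := abs_integral_le_integral_abs
        _ ≤ ∫ ω, (1 / 2 * centredMul μ e p ω ^ 2 + 1 / 2 * centredMul μ e p' ω ^ 2) ∂μ := by
            refine integral_mono
              ((he.memLp_centredMul p).integrable_mul (he.memLp_centredMul p')).abs
              (i1.add i2) fun ω => ?_
            dsimp only
            rw [abs_le]
            constructor
            · nlinarith [sq_nonneg (centredMul μ e p ω + centredMul μ e p' ω)]
            · nlinarith [sq_nonneg (centredMul μ e p ω - centredMul μ e p' ω)]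
        _ = 1 / 2 * ∫ ω, centredMul μ e p ω ^ 2 ∂μ + 1 / 2 * ∫ ω, centredMul μ e p' ω ^ 2 ∂μ := by
            rw [integral_add i1 i2, integral_const_mul, integral_const_mul]
        _ ≤ κ := by linarith [he.integral_centredMul_sq_le p, he.integral_centredMul_sq_le p']
    refine hle.trans ?_
    have h0 : (0 : ℝ) ≤ if p' = p then 1 else 0 := by split_ifs <;> norm_num
    have h0' : (0 : ℝ) ≤ if p' = p.swap then 1 else 0 := by split_ifs <;> norm_num
    have : (1 : ℝ) ≤ (if p' = p then 1 else 0) + if p' = p.swap then 1 else 0 := by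
      rcases h with h | h
      · rw [if_pos h]; linarith
      · rw [if_pos h]; linarith
    nlinarith
  · push Not at h
    rw [if_neg h.1, if_neg h.2, he.integral_centredMul_mul, he.integral_mul_mul_eq, sub_self]
    · simp
    · exact fun hh => h.1 (Prod.ext hh.1 hh.2)
    · exact fun hh => h.2 (Prod.ext hh.1 hh.2)

/-- Each row of the covariance matrix has at most two relevant entries, and symmetry of `Q` gives
both the weight `Q p ^ 2`, so the squared Hilbert–Schmidt norm controls the variance. -/
theorem integral_sq_quadratic_le (he : IsInnovation μ e σ2 κ) (s : Finset ℕ) {Q : ℕ × ℕ → ℝ}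
    (hQ : ∀ p, Q p.swap = Q p) :
    ∫ ω, (∑ p ∈ s ×ˢ s, Q p * centredMul μ e p ω) ^ 2 ∂μ ≤ 2 * κ * ∑ p ∈ s ×ˢ s, Q p ^ 2 := by
  rw [integral_sq_sum_eq _ Q he.memLp_centredMul, Finset.mul_sum]
  refine Finset.sum_le_sum fun p hp => ?_
  have hsw : p.swap ∈ s ×ˢ s := by
    rw [Finset.mem_product] at hp ⊢; exact ⟨hp.2, hp.1⟩
  calc ∑ p' ∈ s ×ˢ s, Q p * Q p' * ∫ ω, centredMul μ e p ω * centredMul μ e p' ω ∂μ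
      ≤ ∑ p' ∈ s ×ˢ s, |Q p * Q p'| *
          (κ * ((if p' = p then 1 else 0) + if p' = p.swap then 1 else 0)) := by
        refine Finset.sum_le_sum fun p' _ => (le_abs_self _).trans ?_
        rw [abs_mul]
        exact mul_le_mul_of_nonneg_left (he.abs_integral_centredMul_mul_le p p') (abs_nonneg _)
    _ = κ * (|Q p * Q p| + |Q p * Q p.swap|) := by
        simp_rw [mul_add, Finset.sum_add_distrib, mul_ite, mul_one, mul_zero]
        rw [Finset.sum_ite_eq' _ p, Finset.sum_ite_eq' _ p.swap, if_pos hp, if_pos hsw]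
        ring
    _ = 2 * κ * Q p ^ 2 := by
        rw [hQ, ← sq, abs_of_nonneg (sq_nonneg _)]; ring

end IsInnovation

end Innovations

/-! ### A law of large numbers for squares of stable filter outputs -/

section LawOfLargeNumbers

theorem tendsto_average_congr {f g : ℕ → ℝ} {L : ℝ} (hfg : ∀ᶠ l in atTop, f l = g l)
    (hf : Tendsto (fun K : ℕ => (∑ l ∈ Finset.range K, f l) / K) atTop (𝓝 L)) :
    Tendsto (fun K : ℕ => (∑ l ∈ Finset.range K, g l) / K) atTop (𝓝 L) := by
  have h0 : Tendsto (fun l => g l - f l) atTop (𝓝 0) :=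
    tendsto_const_nhds.congr' (hfg.mono fun l hl => by simp [hl])
  have h := hf.add h0.cesaro
  rw [add_zero] at h
  refine h.congr fun K => ?_
  rw [Finset.sum_sub_distrib]
  ring

variable {Ω : Type*} [MeasurableSpace Ω] {μ : Measure Ω}

/-- Along perfect squares the variances of the averages are summable, so the averages converge
there. Nonnegative terms make the partial sums monotone, and consecutive squares have ratio tending
to one, which fills the gaps. -/
theorem ae_tendsto_average_of_variance_le {X : ℕ → Ω → ℝ} {m : ℕ → ℝ} {D L : ℝ}
    (hX : ∀ l, Measurable (X l)) (hX0 : ∀ l ω, 0 ≤ X l ω)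
    (hint : ∀ K, Integrable (fun ω => (∑ l ∈ Finset.range K, (X l ω - m l)) ^ 2) μ)
    (hvar : ∀ K : ℕ, ∫ ω, (∑ l ∈ Finset.range K, (X l ω - m l)) ^ 2 ∂μ ≤ D * K)
    (hm : Tendsto (fun K : ℕ => (∑ l ∈ Finset.range K, m l) / K) atTop (𝓝 L)) :
    ∀ᵐ ω ∂μ, Tendsto (fun K : ℕ => (∑ l ∈ Finset.range K, X l ω) / K) atTop (𝓝 L) := by
  set c : ℕ → ℕ := fun n => (n + 1) ^ 2 with hc
  have hc_tendsto : Tendsto c atTop atTop :=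
    tendsto_atTop_mono (fun n => by simp only [hc, id]; nlinarith) tendsto_id
  set S : ℕ → Ω → ℝ := fun K ω => ∑ l ∈ Finset.range K, (X l ω - m l) with hS
  have hSm : ∀ K, Measurable (S K) := fun K =>
    Finset.measurable_fun_sum _ fun l _ => (hX l).sub_const _
  have hsum : ∑' n : ℕ, ∫⁻ ω, ENNReal.ofReal ((S (c n) ω / (c n : ℝ)) ^ 2) ∂μ ≠ ⊤ := by
    have hle : ∀ n : ℕ, ∫⁻ ω, ENNReal.ofReal ((S (c n) ω / (c n : ℝ)) ^ 2) ∂μ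
        ≤ ENNReal.ofReal (D * (1 / ((n + 1 : ℕ) : ℝ) ^ 2)) := by
      intro n
      have hn : (0 : ℝ) < (n + 1 : ℕ) := by positivity
      have hi : Integrable (fun ω => (S (c n) ω / (c n : ℝ)) ^ 2) μ := by
        simp_rw [div_pow]
        exact (hint (c n)).div_const _
      rw [← ofReal_integral_eq_lintegral_ofReal hi (ae_of_all _ fun ω => sq_nonneg _)]
      apply ENNReal.ofReal_le_ofReal
      simp_rw [div_pow]
      rw [integral_div, div_le_iff₀ (by simp only [hc]; positivity)]
      refine (hvar (c n)).trans (le_of_eq ?_)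
      simp only [hc]
      push_cast at hn ⊢
      field_simp
    refine ne_top_of_le_ne_top ?_ (ENNReal.tsum_le_tsum hle)
    have hs : Summable fun n : ℕ => D * (1 / ((n + 1 : ℕ) : ℝ) ^ 2) :=
      ((summable_nat_add_iff (f := fun n : ℕ => 1 / (n : ℝ) ^ 2) 1).2
        (Real.summable_one_div_nat_pow.2 one_lt_two)).mul_left D
    exact hs.tsum_ofReal_ne_top
  filter_upwards [ae_tendsto_zero_of_tsum_lintegral_ne_top
    (fun n => (((hSm (c n)).div_const _).pow_const 2).ennreal_ofReal) hsum] with ω hω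
  have hsub : Tendsto (fun n => S (c n) ω / (c n : ℝ)) atTop (𝓝 0) := by
    have h1 : Tendsto (fun n => (S (c n) ω / (c n : ℝ)) ^ 2) atTop (𝓝 0) := by
      have := (ENNReal.tendsto_toReal ENNReal.zero_ne_top).comp hω
      refine this.congr fun n => ?_
      simp [ENNReal.toReal_ofReal (sq_nonneg _)]
    have h2 := h1.sqrt
    simp_rw [Real.sqrt_sq_eq_abs, Real.sqrt_zero] at h2
    exact (tendsto_zero_iff_abs_tendsto_zero _).2 h2
  refine tendsto_div_of_monotone_of_exists_subseq_tendsto_div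
    (fun K => ∑ l ∈ Finset.range K, X l ω) L ?_ ?_
  · intro K K' hK
    exact Finset.sum_le_sum_of_subset_of_nonneg (Finset.range_mono hK) fun l _ _ => hX0 l ω
  · intro a ha
    refine ⟨c, ?_, hc_tendsto, ?_⟩
    -- The threshold comes from `(n + 2)² - (n + 1)² = 2n + 3 ≤ 3 (n + 1)`, which is at most `(a -
    -- 1) (n + 1)²` once `3 ≤ (a - 1) n`.
    · filter_upwards [tendsto_natCast_atTop_atTop.eventually_ge_atTop (3 / (a - 1))] with n hn
      rw [div_le_iff₀ (by linarith)] at hn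
      simp only [hc]
      push_cast
      have h0 : (0 : ℝ) ≤ n := Nat.cast_nonneg n
      nlinarith
    · have h := hsub.add (hm.comp hc_tendsto)
      rw [zero_add] at h
      refine h.congr fun n => ?_
      simp only [hS, Function.comp, Finset.sum_sub_distrib]
      ring

/-- A lower triangular array whose rows and columns are absolutely summable, uniformly. -/
structure IsStableKernel (A : ℕ → ℕ → ℝ) (C : ℝ) : Prop where
  support : ∀ k j, k < j → A k j = 0
  row : ∀ k K, ∑ j ∈ Finset.range K, |A k j| ≤ C
  col : ∀ j K, ∑ k ∈ Finset.range K, |A k j| ≤ C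

namespace IsStableKernel

variable {A : ℕ → ℕ → ℝ} {C : ℝ}

theorem nonneg (hA : IsStableKernel A C) : 0 ≤ C := by simpa using hA.row 0 0

theorem abs_le (hA : IsStableKernel A C) (k j : ℕ) : |A k j| ≤ C :=
  (Finset.single_le_sum (f := fun j => |A k j|) (fun _ _ => abs_nonneg _)
    (Finset.self_mem_range_succ j)).trans (hA.row k (j + 1))

theorem sum_range_eq (hA : IsStableKernel A C) (g : ℕ → ℝ) {k K : ℕ} (hk : k < K) :
    ∑ j ∈ Finset.range (k + 1), A k j * g j = ∑ j ∈ Finset.range K, A k j * g j := by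
  refine Finset.sum_subset (Finset.range_mono hk) fun j _ hj => ?_
  rw [hA.support k j (by simpa using hj), zero_mul]

/-- The Gram matrix of the absolute values has entries and row sums at most `C²`; bounding one
factor of each square by its maximum leaves `C²` times the sum of `K` rows. -/
theorem sum_sq_gram_le (hA : IsStableKernel A C) (K : ℕ) :
    ∑ p ∈ Finset.range K ×ˢ Finset.range K,
      (∑ l ∈ Finset.range K, A l p.1 * A l p.2) ^ 2 ≤ C ^ 4 * K := by
  have hC := hA.nonneg
  set G : ℕ → ℕ → ℝ := fun i j => ∑ l ∈ Finset.range K, |A l i| * |A l j| with hG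
  have hG0 : ∀ i j, 0 ≤ G i j := fun i j =>
    Finset.sum_nonneg fun l _ => mul_nonneg (abs_nonneg _) (abs_nonneg _)
  have hGle : ∀ i j, G i j ≤ C ^ 2 := by
    intro i j
    calc G i j ≤ ∑ l ∈ Finset.range K, |A l i| * C :=
          Finset.sum_le_sum fun l _ => mul_le_mul_of_nonneg_left (hA.abs_le l j) (abs_nonneg _)
      _ = (∑ l ∈ Finset.range K, |A l i|) * C := by rw [Finset.sum_mul]
      _ ≤ C * C := mul_le_mul_of_nonneg_right (hA.col i K) hC
      _ = C ^ 2 := by ring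
  have hGrow : ∀ i, ∑ j ∈ Finset.range K, G i j ≤ C ^ 2 := by
    intro i
    simp only [hG]
    rw [Finset.sum_comm]
    calc ∑ l ∈ Finset.range K, ∑ j ∈ Finset.range K, |A l i| * |A l j|
        = ∑ l ∈ Finset.range K, |A l i| * ∑ j ∈ Finset.range K, |A l j| := by
          simp_rw [Finset.mul_sum]
      _ ≤ ∑ l ∈ Finset.range K, |A l i| * C :=
          Finset.sum_le_sum fun l _ => mul_le_mul_of_nonneg_left (hA.row l K) (abs_nonneg _)
      _ = (∑ l ∈ Finset.range K, |A l i|) * C := by rw [Finset.sum_mul]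
      _ ≤ C * C := mul_le_mul_of_nonneg_right (hA.col i K) hC
      _ = C ^ 2 := by ring
  rw [Finset.sum_product]
  calc ∑ i ∈ Finset.range K, ∑ j ∈ Finset.range K, (∑ l ∈ Finset.range K, A l i * A l j) ^ 2
      ≤ ∑ i ∈ Finset.range K, ∑ j ∈ Finset.range K, C ^ 2 * G i j := by
        refine Finset.sum_le_sum fun i _ => Finset.sum_le_sum fun j _ => ?_
        have h : |∑ l ∈ Finset.range K, A l i * A l j| ≤ G i j := by
          refine (Finset.abs_sum_le_sum_abs _ _).trans (le_of_eq ?_)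
          simp [hG, abs_mul]
        rw [← sq_abs]
        nlinarith [hG0 i j, hGle i j, abs_nonneg (∑ l ∈ Finset.range K, A l i * A l j)]
    _ = ∑ i ∈ Finset.range K, C ^ 2 * ∑ j ∈ Finset.range K, G i j := by
        simp_rw [Finset.mul_sum]
    _ ≤ ∑ i ∈ Finset.range K, C ^ 2 * C ^ 2 :=
        Finset.sum_le_sum fun i _ => mul_le_mul_of_nonneg_left (hGrow i) (sq_nonneg C)
    _ = C ^ 4 * K := by simp; ring

theorem add {B : ℕ → ℕ → ℝ} {C' : ℝ} (hA : IsStableKernel A C) (hB : IsStableKernel B C') :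
    IsStableKernel (fun k j => A k j + B k j) (C + C') where
  support k j h := by simp [hA.support k j h, hB.support k j h]
  row k K := (Finset.sum_le_sum fun j _ => abs_add_le _ _).trans
    (by rw [Finset.sum_add_distrib]; exact add_le_add (hA.row k K) (hB.row k K))
  col j K := (Finset.sum_le_sum fun k _ => abs_add_le _ _).trans
    (by rw [Finset.sum_add_distrib]; exact add_le_add (hA.col j K) (hB.col j K))

theorem mono {C' : ℝ} (hA : IsStableKernel A C) (h : C ≤ C') : IsStableKernel A C' where
  support := hA.support
  row k K := (hA.row k K).trans h
  col j K := (hA.col j K).trans h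

theorem neg (hA : IsStableKernel A C) : IsStableKernel (fun k j => -A k j) C where
  support k j h := by simp [hA.support k j h]
  row k K := by simpa using hA.row k K
  col j K := by simpa using hA.col j K

theorem delay (hA : IsStableKernel A C) (p : ℕ) :
    IsStableKernel (fun k j => if p ≤ k then A (k - p) j else 0) C where
  support k j h := by
    split_ifs
    · exact hA.support _ _ (by omega)
    · rfl
  row k K := by
    split_ifs
    · exact hA.row _ _
    · simpa using hA.nonneg
  col j K := by
    rcases le_or_gt p K with h | h
    · obtain ⟨q, rfl⟩ := Nat.exists_eq_add_of_le h
      rw [Finset.sum_range_add]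
      have h1 : ∑ k ∈ Finset.range p, |if p ≤ k then A (k - p) j else 0| = 0 :=
        Finset.sum_eq_zero fun k hk => by
          rw [if_neg (by simpa using hk), abs_zero]
      rw [h1, zero_add]
      simpa using hA.col j q
    · rw [Finset.sum_eq_zero fun k hk => ?_]
      · exact hA.nonneg
      · have := Finset.mem_range.1 hk
        rw [if_neg (by omega), abs_zero]

/-- Indexed by the lag `k - j`, both row and column sums are dominated by partial sums of `H`. -/
theorem of_summable {h : ℕ → ℕ → ℝ} {H : ℕ → ℝ} (hH : Summable H)
    (hle : ∀ k i, |h k i| ≤ H i) :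
    IsStableKernel (fun k j => if j ≤ k then h k (k - j) else 0) (∑' i, H i) := by
  have hH0 : ∀ i, 0 ≤ H i := fun i => (abs_nonneg _).trans (hle 0 i)
  have hpart : ∀ K, ∑ i ∈ Finset.range K, H i ≤ ∑' i, H i := fun K =>
    hH.sum_le_tsum _ fun i _ => hH0 i
  refine ⟨fun k j hkj => if_neg (by omega), fun k K => ?_, fun j K => ?_⟩
  · calc ∑ j ∈ Finset.range K, |if j ≤ k then h k (k - j) else 0|
        = ∑ j ∈ Finset.range K with j ≤ k, |h k (k - j)| := by
          rw [Finset.sum_filter]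
          exact Finset.sum_congr rfl fun j _ => by split_ifs <;> simp
      _ ≤ ∑ j ∈ Finset.range (k + 1), |h k (k - j)| := by
          refine Finset.sum_le_sum_of_subset_of_nonneg (fun j hj => ?_) fun _ _ _ => abs_nonneg _
          simp only [Finset.mem_filter, Finset.mem_range] at hj ⊢
          omega
      _ ≤ ∑ j ∈ Finset.range (k + 1), H (k + 1 - 1 - j) :=
          Finset.sum_le_sum fun j _ => hle k (k - j)
      _ = ∑ j ∈ Finset.range (k + 1), H j := Finset.sum_range_reflect H (k + 1)
      _ ≤ _ := hpart _
  · calc ∑ k ∈ Finset.range K, |if j ≤ k then h k (k - j) else 0|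
        ≤ ∑ k ∈ Finset.range (j + K), |if j ≤ k then h k (k - j) else 0| :=
          Finset.sum_le_sum_of_subset_of_nonneg (Finset.range_mono (by omega))
            fun _ _ _ => abs_nonneg _
      _ = ∑ k ∈ Finset.range K, |h (j + k) k| := by
          rw [Finset.sum_range_add, Finset.sum_eq_zero fun k hk => ?_, zero_add]
          · simp
          · rw [if_neg (by simpa using hk), abs_zero]
      _ ≤ ∑ k ∈ Finset.range K, H k := Finset.sum_le_sum fun k _ => hle _ k
      _ ≤ _ := hpart _

end IsStableKernel

/-- `x` is, from some time on, a bounded deterministic sequence plus the output of a uniformly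
stable time-varying filter driven by `e`. -/
def IsFilterOutput (μ : Measure Ω) (e : ℕ → Ω → ℝ) (x : ℕ → Ω → ℝ) : Prop :=
  ∃ (c : ℕ → ℝ) (A : ℕ → ℕ → ℝ) (C : ℝ), (∀ k, |c k| ≤ C) ∧ IsStableKernel A C ∧
    ∀ᶠ k in atTop, ∀ᵐ ω ∂μ, x k ω = c k + ∑ j ∈ Finset.range (k + 1), A k j * e j ω

namespace IsFilterOutput

variable {e : ℕ → Ω → ℝ} {x x' : ℕ → Ω → ℝ}

theorem add (hx : IsFilterOutput μ e x) (hx' : IsFilterOutput μ e x') :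
    IsFilterOutput μ e fun k ω => x k ω + x' k ω := by
  obtain ⟨c, A, C, hc, hA, h⟩ := hx
  obtain ⟨c', A', C', hc', hA', h'⟩ := hx'
  refine ⟨fun k => c k + c' k, fun k j => A k j + A' k j, C + C',
    fun k => (abs_add_le _ _).trans (add_le_add (hc k) (hc' k)), hA.add hA', ?_⟩
  filter_upwards [h, h'] with k hk hk'
  filter_upwards [hk, hk'] with ω e1 e2
  rw [e1, e2]
  simp only [add_mul, Finset.sum_add_distrib]
  ring

theorem neg (hx : IsFilterOutput μ e x) : IsFilterOutput μ e fun k ω => -x k ω := by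
  obtain ⟨c, A, C, hc, hA, h⟩ := hx
  refine ⟨fun k => -c k, fun k j => -A k j, C, fun k => by simpa using hc k, hA.neg, ?_⟩
  filter_upwards [h] with k hk
  filter_upwards [hk] with ω e1
  rw [e1]
  simp only [neg_mul, Finset.sum_neg_distrib]
  ring

theorem delay {y : ℤ → Ω → ℝ} (hy : IsFilterOutput μ e fun k => y k) (p : ℕ) :
    IsFilterOutput μ e fun k => y ((k : ℤ) - p) := by
  obtain ⟨c, A, C, hc, hA, h⟩ := hy
  refine ⟨fun k => c (k - p), _, C, fun k => hc _, hA.delay p, ?_⟩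
  obtain ⟨K, hK⟩ := eventually_atTop.1 h
  filter_upwards [eventually_ge_atTop (K + p)] with k hk
  filter_upwards [hK (k - p) (by omega)] with ω hω
  rw [← Nat.cast_sub (by omega), hω]
  congr 1
  simp only [if_pos (show p ≤ k by omega)]
  exact hA.sum_range_eq (fun j => e j ω) (by omega)

end IsFilterOutput

variable [IsProbabilityMeasure μ] {e : ℕ → Ω → ℝ} {σ2 κ : ℝ}

/-- The squares of a stable filter output have a partial sum whose variance grows linearly. -/
theorem IsInnovation.variance_sum_sq_le (he : IsInnovation μ e σ2 κ) {c : ℕ → ℝ}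
    {A : ℕ → ℕ → ℝ} {C : ℝ} (hc : ∀ k, |c k| ≤ C) (hA : IsStableKernel A C) {w : ℕ → Ω → ℝ}
    (hw : ∀ k ω, w k ω = c k + ∑ j ∈ Finset.range (k + 1), A k j * e j ω) (K : ℕ) :
    Integrable (fun ω => (∑ l ∈ Finset.range K, (w l ω ^ 2 - ∫ ω', w l ω' ^ 2 ∂μ)) ^ 2) μ ∧
    ∫ ω, (∑ l ∈ Finset.range K, (w l ω ^ 2 - ∫ ω', w l ω' ^ 2 ∂μ)) ^ 2 ∂μ
      ≤ (8 * σ2 + 4 * κ) * C ^ 4 * K := by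
  have hC := hA.nonneg
  set R := Finset.range K with hR
  -- Expanding the squares, `b` collects the coefficients of the linear part in `e` and `Q` those of
  -- the quadratic part; the deterministic squares cancel against the means.
  set b : ℕ → ℝ := fun j => ∑ l ∈ R, 2 * c l * A l j with hb
  set Q : ℕ × ℕ → ℝ := fun p => ∑ l ∈ R, A l p.1 * A l p.2 with hQ
  have hexp : ∀ l ∈ R, ∀ ω, w l ω ^ 2 = c l ^ 2 + ∑ j ∈ R, 2 * c l * A l j * e j ω
      + ∑ p ∈ R ×ˢ R, A l p.1 * A l p.2 * (e p.1 ω * e p.2 ω) := by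
    intro l hl ω
    have h1 : ∑ p ∈ R ×ˢ R, A l p.1 * A l p.2 * (e p.1 ω * e p.2 ω)
        = (∑ j ∈ R, A l j * e j ω) * ∑ j ∈ R, A l j * e j ω := by
      rw [Finset.sum_product, Finset.sum_mul_sum]
      exact Finset.sum_congr rfl fun i _ => Finset.sum_congr rfl fun j _ => by ring
    have h2 : ∑ j ∈ R, 2 * c l * A l j * e j ω = 2 * c l * ∑ j ∈ R, A l j * e j ω := by
      rw [Finset.mul_sum]; exact Finset.sum_congr rfl fun j _ => by ring
    rw [h1, h2, hw, hA.sum_range_eq (fun j => e j ω) (Finset.mem_range.1 hl)]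
    ring
  have hmean : ∀ l ∈ R, ∫ ω, w l ω ^ 2 ∂μ = c l ^ 2
      + ∑ p ∈ R ×ˢ R, A l p.1 * A l p.2 * ∫ ω, e p.1 ω * e p.2 ω ∂μ := by
    intro l hl
    rw [integral_congr_ae (ae_of_all _ (hexp l hl))]
    have i1 : ∀ j, Integrable (fun ω => 2 * c l * A l j * e j ω) μ := fun j =>
      ((he.memLp_two j).integrable one_le_two).const_mul _
    have i2 : ∀ p : ℕ × ℕ, Integrable (fun ω => A l p.1 * A l p.2 * (e p.1 ω * e p.2 ω)) μ :=
      fun p => ((he.memLp_mul p.1 p.2).integrable one_le_two).const_mul _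
    have i3 : Integrable (fun ω => c l ^ 2 + ∑ j ∈ R, 2 * c l * A l j * e j ω) μ :=
      (integrable_const _).add (integrable_finsetSum _ fun j _ => i1 j)
    rw [integral_add i3 (integrable_finsetSum _ fun p _ => i2 p),
      integral_add (integrable_const _) (integrable_finsetSum _ fun j _ => i1 j),
      integral_finsetSum _ fun j _ => i1 j, integral_finsetSum _ fun p _ => i2 p]
    simp_rw [integral_const_mul, he.mean]
    simp
  have hdecomp : ∀ ω, ∑ l ∈ R, (w l ω ^ 2 - ∫ ω', w l ω' ^ 2 ∂μ)
      = ∑ j ∈ R, b j * e j ω + ∑ p ∈ R ×ˢ R, Q p * centredMul μ e p ω := by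
    intro ω
    have h1 : ∀ l ∈ R, w l ω ^ 2 - ∫ ω', w l ω' ^ 2 ∂μ = ∑ j ∈ R, 2 * c l * A l j * e j ω
        + ∑ p ∈ R ×ˢ R, A l p.1 * A l p.2 * centredMul μ e p ω := by
      intro l hl
      rw [hmean l hl, hexp l hl ω]
      simp only [centredMul, mul_sub, Finset.sum_sub_distrib]
      ring
    rw [Finset.sum_congr rfl h1, Finset.sum_add_distrib, Finset.sum_comm]
    congr 1
    · exact Finset.sum_congr rfl fun j _ => by rw [hb, Finset.sum_mul]
    · rw [Finset.sum_comm]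
      exact Finset.sum_congr rfl fun p _ => by rw [hQ, Finset.sum_mul]
  have mX : MemLp (fun ω => ∑ j ∈ R, b j * e j ω) 2 μ :=
    memLp_finsetSum _ fun j _ => (he.memLp_two j).const_mul _
  have mY : MemLp (fun ω => ∑ p ∈ R ×ˢ R, Q p * centredMul μ e p ω) 2 μ :=
    memLp_finsetSum _ fun p _ => (he.memLp_centredMul p).const_mul _
  simp_rw [hdecomp]
  refine ⟨(mX.add mY).integrable_sq, ?_⟩
  have hbj : ∀ j, b j ^ 2 ≤ 4 * C ^ 4 := by
    intro j
    have h : |b j| ≤ 2 * C ^ 2 := by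
      calc |b j| ≤ ∑ l ∈ R, |2 * c l * A l j| := Finset.abs_sum_le_sum_abs _ _
        _ ≤ ∑ l ∈ R, 2 * C * |A l j| := by
            refine Finset.sum_le_sum fun l _ => ?_
            rw [abs_mul, abs_mul, abs_two]
            exact mul_le_mul_of_nonneg_right (by linarith [hc l]) (abs_nonneg _)
        _ = 2 * C * ∑ l ∈ R, |A l j| := by rw [Finset.mul_sum]
        _ ≤ 2 * C * C := mul_le_mul_of_nonneg_left (hA.col j K) (by linarith)
        _ = 2 * C ^ 2 := by ring
    calc b j ^ 2 = |b j| ^ 2 := (sq_abs _).symm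
      _ ≤ (2 * C ^ 2) ^ 2 := pow_le_pow_left₀ (abs_nonneg _) h 2
      _ = 4 * C ^ 4 := by ring
  have hX : ∫ ω, (∑ j ∈ R, b j * e j ω) ^ 2 ∂μ ≤ σ2 * (4 * C ^ 4 * K) := by
    rw [he.integral_sq_linear]
    refine mul_le_mul_of_nonneg_left ((Finset.sum_le_sum fun j _ => hbj j).trans (le_of_eq ?_))
      he.sigma_nonneg
    simp [hR]; ring
  have hY : ∫ ω, (∑ p ∈ R ×ˢ R, Q p * centredMul μ e p ω) ^ 2 ∂μ ≤ 2 * κ * (C ^ 4 * K) := by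
    refine (he.integral_sq_quadratic_le R fun p => ?_).trans
      (mul_le_mul_of_nonneg_left (hA.sum_sq_gram_le K) (by linarith [he.kappa_nonneg]))
    exact Finset.sum_congr rfl fun l _ => mul_comm _ _
  calc ∫ ω, (∑ j ∈ R, b j * e j ω + ∑ p ∈ R ×ˢ R, Q p * centredMul μ e p ω) ^ 2 ∂μ
      ≤ ∫ ω, (2 * (∑ j ∈ R, b j * e j ω) ^ 2
          + 2 * (∑ p ∈ R ×ˢ R, Q p * centredMul μ e p ω) ^ 2) ∂μ := by
        refine integral_mono (mX.add mY).integrable_sq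
          ((mX.integrable_sq.const_mul 2).add (mY.integrable_sq.const_mul 2)) fun ω => ?_
        dsimp only
        nlinarith [sq_nonneg (∑ j ∈ R, b j * e j ω - ∑ p ∈ R ×ˢ R, Q p * centredMul μ e p ω)]
    _ = 2 * ∫ ω, (∑ j ∈ R, b j * e j ω) ^ 2 ∂μ
          + 2 * ∫ ω, (∑ p ∈ R ×ˢ R, Q p * centredMul μ e p ω) ^ 2 ∂μ := by
        rw [integral_add (mX.integrable_sq.const_mul 2) (mY.integrable_sq.const_mul 2),
          integral_const_mul, integral_const_mul]
    _ ≤ (8 * σ2 + 4 * κ) * C ^ 4 * K := by nlinarith [hX, hY]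

namespace IsFilterOutput

variable {x x' : ℕ → Ω → ℝ}

theorem ae_tendsto_average_sq (he : IsInnovation μ e σ2 κ) (hx : IsFilterOutput μ e x) {L : ℝ}
    (hL : Tendsto (fun K : ℕ => (∑ l ∈ Finset.range K, ∫ ω, x l ω ^ 2 ∂μ) / K) atTop (𝓝 L)) :
    ∀ᵐ ω ∂μ, Tendsto (fun K : ℕ => (∑ l ∈ Finset.range K, x l ω ^ 2) / K) atTop (𝓝 L) := by
  obtain ⟨c, A, C, hc, hA, h⟩ := hx
  set w : ℕ → Ω → ℝ := fun k ω => c k + ∑ j ∈ Finset.range (k + 1), A k j * e j ω with hw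
  have hvar := he.variance_sum_sq_le hc hA (w := w) fun _ _ => rfl
  have hwm : ∀ l, Measurable (w l) := fun l =>
    (Finset.measurable_fun_sum _ fun j _ => (he.measurable j).const_mul _).const_add _
  have hmean : Tendsto (fun K : ℕ => (∑ l ∈ Finset.range K, ∫ ω, w l ω ^ 2 ∂μ) / K) atTop
      (𝓝 L) := by
    refine tendsto_average_congr (h.mono fun k hk => integral_congr_ae ?_) hL
    filter_upwards [hk] with ω hω
    rw [hω]
  have hlim := ae_tendsto_average_of_variance_le (X := fun l ω => w l ω ^ 2)
    (fun l => (hwm l).pow_const 2) (fun l ω => sq_nonneg _) (fun K => (hvar K).1)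
    (fun K => (hvar K).2) hmean
  obtain ⟨K₀, hK₀⟩ := eventually_atTop.1 h
  have hall : ∀ᵐ ω ∂μ, ∀ k, K₀ ≤ k → x k ω = w k ω := by
    rw [ae_all_iff]
    intro k
    by_cases hk : K₀ ≤ k
    · filter_upwards [hK₀ k hk] with ω hω _ using hω
    · exact ae_of_all _ fun ω hk' => absurd hk' hk
  filter_upwards [hlim, hall] with ω h1 h2
  refine tendsto_average_congr ?_ h1
  filter_upwards [eventually_ge_atTop K₀] with k hk
  rw [h2 k hk]

/-- Polarization: the strong law needs nonnegative terms, so it is applied to the squares of `x`,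
`x'` and `x + x'`, the last again a filter output. -/
theorem ae_tendsto_average_mul (he : IsInnovation μ e σ2 κ) (hx : IsFilterOutput μ e x)
    (hx' : IsFilterOutput μ e x') (hL2 : ∀ l, MemLp (x l) 2 μ) (hL2' : ∀ l, MemLp (x' l) 2 μ)
    {a b c : ℝ}
    (ha : Tendsto (fun K : ℕ => (∑ l ∈ Finset.range K, ∫ ω, x l ω * x l ω ∂μ) / K) atTop (𝓝 a))
    (hb : Tendsto (fun K : ℕ => (∑ l ∈ Finset.range K, ∫ ω, x' l ω * x' l ω ∂μ) / K) atTop (𝓝 b))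
    (hc : Tendsto (fun K : ℕ => (∑ l ∈ Finset.range K, ∫ ω, x l ω * x' l ω ∂μ) / K) atTop
      (𝓝 c)) :
    ∀ᵐ ω ∂μ, Tendsto (fun K : ℕ => (∑ l ∈ Finset.range K, x l ω * x' l ω) / K) atTop (𝓝 c) := by
  simp_rw [← sq] at ha hb
  have hsum : Tendsto (fun K : ℕ => (∑ l ∈ Finset.range K, ∫ ω, (x l ω + x' l ω) ^ 2 ∂μ) / K)
      atTop (𝓝 (a + 2 * c + b)) := by
    refine ((ha.add (hc.const_mul 2)).add hb).congr fun K => ?_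
    have h : ∀ l, ∫ ω, (x l ω + x' l ω) ^ 2 ∂μ
        = ∫ ω, x l ω ^ 2 ∂μ + 2 * ∫ ω, x l ω * x' l ω ∂μ + ∫ ω, x' l ω ^ 2 ∂μ := by
      intro l
      have i1 := (hL2 l).integrable_sq
      have i2 : Integrable (fun ω => 2 * (x l ω * x' l ω)) μ :=
        ((hL2 l).integrable_mul (hL2' l)).const_mul 2
      have i12 : Integrable (fun ω => x l ω ^ 2 + 2 * (x l ω * x' l ω)) μ := i1.add i2
      rw [← integral_const_mul, ← integral_add i1 i2, ← integral_add i12 (hL2' l).integrable_sq]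
      exact integral_congr_ae (ae_of_all _ fun ω => by ring)
    simp_rw [h, Finset.sum_add_distrib, ← Finset.mul_sum]
    ring
  filter_upwards [hx.ae_tendsto_average_sq he ha, hx'.ae_tendsto_average_sq he hb,
    (hx.add hx').ae_tendsto_average_sq he hsum] with ω h1 h2 h3
  have h4 := ((h3.sub h1).sub h2).div_const 2
  rw [show (a + 2 * c + b - a - b) / 2 = c by ring] at h4
  refine h4.congr fun K => ?_
  have h5 : ∑ l ∈ Finset.range K, (x l ω + x' l ω) ^ 2 = ∑ l ∈ Finset.range K, x l ω ^ 2
      + 2 * ∑ l ∈ Finset.range K, x l ω * x' l ω + ∑ l ∈ Finset.range K, x' l ω ^ 2 := by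
    rw [Finset.mul_sum, ← Finset.sum_add_distrib, ← Finset.sum_add_distrib]
    exact Finset.sum_congr rfl fun l _ => by ring
  rw [h5]
  ring

end IsFilterOutput

end LawOfLargeNumbers

/-! ### The information in the past data -/

section PastData

variable {Ω : Type*}

/-- The information carried by the data up to time `k`. -/
abbrev pastData (y u : ℤ → Ω → ℝ) (k : ℕ) : MeasurableSpace Ω :=
  MeasurableSpace.comap
    (fun ω (j : Fin (k + 1)) => (y ((j : ℕ) : ℤ) ω, u ((j : ℕ) : ℤ) ω)) inferInstance

theorem measurable_pastData_pair (y u : ℤ → Ω → ℝ) {j k : ℕ} (hjk : j ≤ k) :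
    Measurable[pastData y u k] fun ω => (y (j : ℤ) ω, u (j : ℤ) ω) :=
  (measurable_pi_apply (X := fun _ : Fin (k + 1) => ℝ × ℝ) ⟨j, by omega⟩).comp
    (comap_measurable fun ω (j : Fin (k + 1)) => (y ((j : ℕ) : ℤ) ω, u ((j : ℕ) : ℤ) ω))

theorem pastData_mono (y u : ℤ → Ω → ℝ) (k : ℕ) : pastData y u k ≤ pastData y u (k + 1) := by
  have h : Measurable[pastData y u (k + 1)]
      fun ω (j : Fin (k + 1)) => (y ((j : ℕ) : ℤ) ω, u ((j : ℕ) : ℤ) ω) :=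
    @measurable_pi_lambda _ _ _ (pastData y u (k + 1)) _ _ fun j =>
      measurable_pastData_pair y u (by omega)
  exact h.comap_le

end PastData

/-! ### The input-output data as stable filter outputs -/

section Data

variable {Ω : Type*} [MeasurableSpace Ω] {μ : Measure Ω}

theorem GeneratedBy.exists_isInnovation {y u : ℤ → Ω → ℝ} {r : ℕ → ℝ} {e : ℕ → Ω → ℝ} {δe2 : ℝ}
    {f₁ f₂ f₃ f₄ : ℕ → ℕ → ℝ} (h : GeneratedBy μ y u r e δe2 f₁ f₂ f₃ f₄) :
    ∃ κ, IsInnovation μ e δe2 κ := by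
  obtain ⟨κ, hκ⟩ := h.moments_e 4 (by norm_num)
  have h4 : ∀ k ω, |e k ω| ^ 4 = e k ω ^ 4 := fun k ω => Even.pow_abs (by decide) _
  simp_rw [h4] at hκ
  exact ⟨κ, h.measurable_e, h.indep_e, h.mean_e, fun k => by
    rw [← variance_of_integral_eq_zero (h.measurable_e k).aemeasurable (h.mean_e k), h.variance_e],
    fun k => (hκ k).1, fun k => (hκ k).2⟩

variable {e : ℕ → Ω → ℝ} {σ2 κ : ℝ}

theorem IsInnovation.integral_const_add_linear [IsProbabilityMeasure μ] (he : IsInnovation μ e σ2 κ) (s : Finset ℕ)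
    (c : ℝ) (b : ℕ → ℝ) : ∫ ω, (c + ∑ j ∈ s, b j * e j ω) ∂μ = c := by
  have hi : ∀ j, Integrable (fun ω => b j * e j ω) μ := fun j =>
    ((he.memLp_two j).integrable one_le_two).const_mul _
  rw [integral_add (integrable_const _) (integrable_finsetSum _ fun j _ => hi j),
    integral_finsetSum _ fun j _ => hi j]
  simp_rw [integral_const_mul, he.mean]
  simp

theorem IsInnovation.le_integral_const_add_linear_sq [IsProbabilityMeasure μ] (he : IsInnovation μ e σ2 κ) (s : Finset ℕ)
    (c : ℝ) (b : ℕ → ℝ) :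
    σ2 * ∑ j ∈ s, b j ^ 2 ≤ ∫ ω, (c + ∑ j ∈ s, b j * e j ω) ^ 2 ∂μ := by
  have hX : MemLp (fun ω => ∑ j ∈ s, b j * e j ω) 2 μ :=
    memLp_finsetSum _ fun j _ => (he.memLp_two j).const_mul _
  have h0 : ∫ ω, ∑ j ∈ s, b j * e j ω ∂μ = 0 := by
    simpa using he.integral_const_add_linear s 0 b
  have h : ∀ ω, (c + ∑ j ∈ s, b j * e j ω) ^ 2
      = c ^ 2 + 2 * c * ∑ j ∈ s, b j * e j ω + (∑ j ∈ s, b j * e j ω) ^ 2 := fun ω => by ring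
  simp_rw [h]
  have i1 : Integrable (fun ω => 2 * c * ∑ j ∈ s, b j * e j ω) μ :=
    (hX.integrable one_le_two).const_mul _
  have i2 : Integrable (fun ω => c ^ 2 + 2 * c * ∑ j ∈ s, b j * e j ω) μ :=
    (integrable_const _).add i1
  rw [integral_add i2 hX.integrable_sq, integral_add (integrable_const _) i1, integral_const_mul,
    h0, he.integral_sq_linear]
  simp
  positivity

/-- A process generated by a filter with summable coefficients at positive lags is a stable filter
output if its first two moments are bounded: these control the coefficient at lag zero. -/
theorem IsInnovation.isFilterOutput [IsProbabilityMeasure μ] (he : IsInnovation μ e σ2 κ) {x : ℕ → Ω → ℝ} {c : ℕ → ℝ}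
    {f : ℕ → ℕ → ℝ} {g : ℕ → ℝ} {B : ℝ}
    (hx : ∀ k, 1 ≤ k → ∀ᵐ ω ∂μ, x k ω = c k + ∑ i ∈ Finset.range (k + 1), f k i * e (k - i) ω)
    (hg : Summable fun i => |g i|) (hf : ∀ k i, 1 ≤ k → 1 ≤ i → |f k i| ≤ |g i|)
    (hmean : ∀ k, |∫ ω, x k ω ∂μ| ≤ B) (hsq : ∀ k, ∫ ω, x k ω ^ 2 ∂μ ≤ B) :
    IsFilterOutput μ e x := by
  have hB : 0 ≤ B := (abs_nonneg _).trans (hmean 0)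
  have hx' : ∀ k, 1 ≤ k → ∀ᵐ ω ∂μ,
      x k ω = c k + ∑ j ∈ Finset.range (k + 1), f k (k - j) * e j ω := by
    intro k hk
    filter_upwards [hx k hk] with ω hω
    rw [hω, ← Finset.sum_range_reflect]
    congr 1
    refine Finset.sum_congr rfl fun j hj => ?_
    have := Finset.mem_range.1 hj
    rw [show k + 1 - 1 - j = k - j by omega, show k - (k - j) = j by omega]
  -- The deterministic part is not assumed bounded, but it is the mean of `x k`, which is.
  have hmean' : ∀ k, 1 ≤ k → ∫ ω, x k ω ∂μ = c k := fun k hk => by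
    rw [integral_congr_ae (hx' k hk), he.integral_const_add_linear]
  -- With zero variance the moments say nothing about the lag-zero coefficients, but `e` vanishes
  -- almost surely and the zero kernel serves.
  by_cases hσ : σ2 = 0
  · refine ⟨fun k => ∫ ω, x k ω ∂μ, fun _ _ => 0, B, hmean,
      ⟨fun _ _ _ => rfl, by simpa using hB, by simpa using hB⟩, ?_⟩
    have hzero : ∀ᵐ ω ∂μ, ∀ j, e j ω = 0 := by
      rw [ae_all_iff]
      intro j
      have h := he.secondMoment j
      rw [hσ, integral_eq_zero_iff_of_nonneg (fun ω => sq_nonneg _)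
        (he.memLp_two j).integrable_sq] at h
      filter_upwards [h] with ω hω
      simpa using hω
    filter_upwards [eventually_ge_atTop 1] with k hk
    filter_upwards [hx' k hk, hzero] with ω h1 h2
    rw [h1, hmean' k hk]
    simp [h2]
  · have hσ0 : 0 < σ2 := lt_of_le_of_ne he.sigma_nonneg (Ne.symm hσ)
    -- The extra term at lag zero comes from `σ2 * f k 0 ^ 2 ≤ E[x k ^ 2] ≤ B`.
    set H : ℕ → ℝ := fun i => |g i| + if i = 0 then Real.sqrt (B / σ2) else 0 with hH
    have hHs : Summable H := hg.add (hasSum_ite_eq 0 _).summable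
    set h : ℕ → ℕ → ℝ := fun k i => if k = 0 then 0 else f k i with hh
    have hite : ∀ i : ℕ, (0 : ℝ) ≤ if i = 0 then Real.sqrt (B / σ2) else 0 := fun i => by
      split_ifs
      · exact Real.sqrt_nonneg _
      · exact le_rfl
    have hH0 : ∀ i, 0 ≤ H i := fun i => add_nonneg (abs_nonneg _) (hite i)
    have hle : ∀ k i, |h k i| ≤ H i := by
      intro k i
      rcases Nat.eq_zero_or_pos k with hk | hk
      · simpa [hh, hk] using hH0 i
      · simp only [hh, if_neg hk.ne']
        rcases Nat.eq_zero_or_pos i with hi | hi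
        · subst hi
          have h1 : f k 0 ^ 2 ≤ ∑ j ∈ Finset.range (k + 1), f k (k - j) ^ 2 := by
            have := Finset.single_le_sum (f := fun j => f k (k - j) ^ 2)
              (fun j _ => sq_nonneg _) (Finset.self_mem_range_succ k)
            simpa using this
          have h2 : σ2 * f k 0 ^ 2 ≤ B := by
            refine (mul_le_mul_of_nonneg_left h1 hσ0.le).trans ?_
            refine (he.le_integral_const_add_linear_sq _ (c k) fun j => f k (k - j)).trans ?_
            refine le_trans (le_of_eq (integral_congr_ae ?_)) (hsq k)
            filter_upwards [hx' k hk] with ω hω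
            rw [hω]
          have h3 : |f k 0| ≤ Real.sqrt (B / σ2) := by
            apply Real.abs_le_sqrt
            rw [le_div_iff₀ hσ0]
            linarith
          simp only [hH, if_true]
          linarith [abs_nonneg (g 0)]
        · exact (hf k i hk hi).trans (le_add_of_nonneg_right (hite i))
    have hT : 0 ≤ ∑' i, H i := tsum_nonneg hH0
    refine ⟨fun k => ∫ ω, x k ω ∂μ, _, B + ∑' i, H i, fun k => (hmean k).trans (by linarith),
      (IsStableKernel.of_summable hHs hle).mono (by linarith), ?_⟩
    filter_upwards [eventually_ge_atTop 1] with k hk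
    filter_upwards [hx' k hk] with ω hω
    rw [hω, hmean' k hk]
    congr 1
    refine Finset.sum_congr rfl fun j hj => ?_
    have hj' := Finset.mem_range.1 hj
    rw [if_pos (show j ≤ k by omega)]
    simp [hh, show k ≠ 0 by omega]

theorem QuasiStationary.isFilterOutput [IsProbabilityMeasure μ] (he : IsInnovation μ e σ2 κ) {x : ℤ → Ω → ℝ}
    (hq : QuasiStationary μ x) {c : ℕ → ℝ} {f : ℕ → ℕ → ℝ} {g : ℕ → ℝ}
    (hx : ∀ k : ℕ, 1 ≤ k → ∀ᵐ ω ∂μ,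
      x k ω = c k + ∑ i ∈ Finset.range (k + 1), f k i * e (k - i) ω)
    (hg : Summable fun i => |g i|) (hf : ∀ k i, 1 ≤ k → 1 ≤ i → |f k i| ≤ |g i|) :
    IsFilterOutput μ e fun k : ℕ => x k := by
  obtain ⟨B, hB1, hB2⟩ := hq.bounded
  refine he.isFilterOutput (x := fun k : ℕ => x k) hx hg hf (fun k => (hB1 k).le) fun k => ?_
  simp_rw [sq]
  exact (le_abs_self _).trans (hB2 k k).le

theorem HasMeanAverage.tendsto_range {x : ℕ → Ω → ℝ} {c : ℝ} (h : HasMeanAverage μ x c) :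
    Tendsto (fun K : ℕ => (∑ l ∈ Finset.range K, ∫ ω, x (l + 1) ω ∂μ) / K) atTop (𝓝 c) := by
  refine h.congr fun K => ?_
  have hsum : ∑ l ∈ Finset.Icc 1 K, ∫ ω, x l ω ∂μ
      = ∑ l ∈ Finset.range K, ∫ ω, x (l + 1) ω ∂μ := by
    induction K with
    | zero => simp
    | succ K ih => rw [Finset.sum_Icc_succ_top (by omega), ih, Finset.sum_range_succ]
  rw [hsum, inv_mul_eq_div]

/-- Regressors satisfy the persistent excitation condition along almost every trajectory. -/
theorem DataAssumption.exists_ae_tendsto [IsProbabilityMeasure μ] {m n : ℕ} {y u : ℤ → Ω → ℝ}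
    (h : DataAssumption μ m n y u) :
    ∃ M : Matrix (Fin (m + n)) (Fin (m + n)) ℝ, M.PosDef ∧ ∀ᵐ ω ∂μ, ∀ i j,
      Tendsto (fun K : ℕ => (∑ l ∈ Finset.range K,
        regressor m n (fun t => y t ω) (fun t => u t ω) (l + 1) i
          * regressor m n (fun t => y t ω) (fun t => u t ω) (l + 1) j) / K) atTop (𝓝 (M i j)) := by
  obtain ⟨M, hM, hlim⟩ := h.persistent_excitation
  obtain ⟨r, e, δe2, f₁, f₂, f₃, f₄, hgen⟩ := h.generated
  obtain ⟨κ, he⟩ := hgen.exists_isInnovation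
  obtain ⟨g, hg, hfg⟩ := hgen.uniformly_stable
  have hy : IsFilterOutput μ e fun k : ℕ => y k :=
    h.quasiStationary_output.isFilterOutput he hgen.output_eq hg
      fun k i hk hi => (hfg k i hk hi).2.1
  have hu : IsFilterOutput μ e fun k : ℕ => u k :=
    h.quasiStationary_input.isFilterOutput he hgen.input_eq hg
      fun k i hk hi => (hfg k i hk hi).2.2.2
  set X : Fin (m + n) → ℕ → Ω → ℝ := fun i l ω =>
    regressor m n (fun t => y t ω) (fun t => u t ω) (l + 1) i with hX
  have hidx : ∀ l p : ℕ, ((l + 1 : ℕ) : ℤ) - 1 - p = (l : ℤ) - p := fun l p => by push_cast; ring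
  have hXf : ∀ i, IsFilterOutput μ e (X i) := by
    intro i
    refine Fin.addCases (fun i => ?_) (fun j => ?_) i
    · simp only [hX, regressor, Fin.append_left, hidx]
      exact (hy.delay i).neg
    · simp only [hX, regressor, Fin.append_right, hidx]
      exact hu.delay j
  have hXm : ∀ i l, MemLp (X i l) 2 μ := by
    intro i l
    refine Fin.addCases (fun i => ?_) (fun j => ?_) i
    · simp only [hX, regressor, Fin.append_left]
      exact (h.quasiStationary_output.memLp _).neg
    · simp only [hX, regressor, Fin.append_right]
      exact h.quasiStationary_input.memLp _
  refine ⟨M, hM, ?_⟩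
  rw [ae_all_iff]
  intro i
  rw [ae_all_iff]
  intro j
  exact (hXf i).ae_tendsto_average_mul he (hXf j) (hXm i) (hXm j) (hlim i i).tendsto_range
    (hlim j j).tendsto_range (hlim i j).tendsto_range

/-! ### The equation error -/

/-- The equation error `y_k - φ_kᵀ θ` of a trajectory. -/
noncomputable def equationError {m n : ℕ} (a : Fin m → ℝ) (b : Fin n → ℝ) (y u : ℤ → Ω → ℝ)
    (k : ℕ) (ω : Ω) : ℝ :=
  y k ω - regressor m n (fun t => y t ω) (fun t => u t ω) k ⬝ᵥ param a b

/-- The noise is thereby replaced by a version that is exactly a function of the data. It is adapted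
without completing σ-algebras, and the regression equation holds on every trajectory. -/
theorem IsARX.equationError_ae_eq {m n : ℕ} {a : Fin m → ℝ} {b : Fin n → ℝ} {y u : ℤ → Ω → ℝ}
    {d : ℕ → Ω → ℝ} (h : IsARX μ a b y u d) {k : ℕ} (hk : 1 ≤ k) :
    d k =ᵐ[μ] equationError a b y u k := by
  filter_upwards [h.equation k hk] with ω hω
  have h1 : regressor m n (fun t => y t ω) (fun t => u t ω) k ⬝ᵥ param a b
      = -∑ i : Fin m, a i * y ((k : ℤ) - 1 - ((i : ℕ) : ℤ)) ω
        + ∑ j : Fin n, b j * u ((k : ℤ) - 1 - ((j : ℕ) : ℤ)) ω := by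
    simp only [dotProduct, regressor, param, Fin.sum_univ_add, Fin.append_left, Fin.append_right]
    simp [mul_comm]
  rw [equationError, h1]
  linarith

theorem IsARX.measurable_pastData {m n : ℕ} {a : Fin m → ℝ} {b : Fin n → ℝ} {y u : ℤ → Ω → ℝ}
    {d : ℕ → Ω → ℝ} (h : IsARX μ a b y u d) {t : ℤ} {k : ℕ} (htk : t ≤ k) :
    Measurable[pastData y u k] (y t) ∧ Measurable[pastData y u k] (u t) := by
  rcases lt_or_ge t 0 with ht | ht
  · have hy : y t = fun _ => 0 := funext fun ω => h.output_zero t ht.le ω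
    have hu : u t = fun _ => 0 := funext fun ω => h.input_zero t ht ω
    rw [hy, hu]
    exact ⟨measurable_const, measurable_const⟩
  · obtain ⟨j, rfl⟩ := Int.eq_ofNat_of_zero_le ht
    have hp := measurable_pastData_pair y u (show j ≤ k by omega)
    exact ⟨measurable_fst.comp hp, measurable_snd.comp hp⟩

theorem IsARX.measurable_regressor {m n : ℕ} {a : Fin m → ℝ} {b : Fin n → ℝ} {y u : ℤ → Ω → ℝ}
    {d : ℕ → Ω → ℝ} (h : IsARX μ a b y u d) (k : ℕ) (i : Fin (m + n)) :
    Measurable[pastData y u k]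
      fun ω => regressor m n (fun t => y t ω) (fun t => u t ω) (k + 1) i := by
  refine Fin.addCases (fun i => ?_) (fun j => ?_) i
  · simp only [regressor, Fin.append_left]
    exact (h.measurable_pastData (by push_cast; omega)).1.neg
  · simp only [regressor, Fin.append_right]
    exact (h.measurable_pastData (by push_cast; omega)).2

theorem IsARX.measurable_equationError {m n : ℕ} {a : Fin m → ℝ} {b : Fin n → ℝ}
    {y u : ℤ → Ω → ℝ} {d : ℕ → Ω → ℝ} (h : IsARX μ a b y u d) (k : ℕ) :
    Measurable[pastData y u (k + 1)] (equationError a b y u (k + 1)) := by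
  refine (h.measurable_pastData le_rfl).1.sub ?_
  simp only [dotProduct]
  exact Finset.measurable_fun_sum _ fun i _ =>
    ((h.measurable_regressor k i).mono (pastData_mono y u k) le_rfl).mul_const _

/-- The correlation of the regressors with the equation error decays at the rate
`√(log k / k)`. -/
theorem ae_regressor_mul_equationError_isBigO [IsProbabilityMeasure μ]
    {m n : ℕ} {a : Fin m → ℝ} {b : Fin n → ℝ}
    {y u : ℤ → Ω → ℝ} {d : ℕ → Ω → ℝ} {δd2 : NNReal} (hsys : IsARX μ a b y u d)
    (hnoise : NoiseAssumption μ y u d δd2) (i : Fin (m + n)) {q : ℝ}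
    (hq : ∀ᵐ ω ∂μ, Tendsto (fun K : ℕ => (∑ l ∈ Finset.range K,
      regressor m n (fun t => y t ω) (fun t => u t ω) (l + 1) i ^ 2) / K) atTop (𝓝 q)) :
    ∀ᵐ ω ∂μ, (fun K : ℕ => (∑ l ∈ Finset.range K,
        regressor m n (fun t => y t ω) (fun t => u t ω) (l + 1) i
          * equationError a b y u (l + 1) ω) / K)
      =O[atTop] fun k : ℕ => Real.sqrt (Real.log k / k) := by
  have hF : ∀ k, pastData y u k ≤ ‹MeasurableSpace Ω› := fun k =>
    Measurable.comap_le (measurable_pi_lambda _ fun j =>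
      (hsys.measurable_output _).prodMk (hsys.measurable_input _))
  refine ae_sum_mul_div_isBigO hF (pastData_mono y u)
    (x := fun l ω => regressor m n (fun t => y t ω) (fun t => u t ω) (l + 1) i)
    (d := fun l => equationError a b y u (l + 1)) (v := δd2)
    (fun k => hsys.measurable_regressor k i) hsys.measurable_equationError ?_ ?_ hq
  -- Independence of `d (k + 1)` from the data at times `j < k + 1` is independence from `pastData y
  -- u k`, and it passes to the almost surely equal equation error.
  · intro k
    have h1 := (hnoise.indep_past (k + 1) (by omega)).congr
      (hsys.equationError_ae_eq (by omega)) EventuallyEq.rfl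
    exact (IndepFun_iff_Indep _ _ _).1 h1.symm
  · intro k
    rw [← hnoise.gaussian (k + 1) (by omega)]
    exact (Measure.map_congr (hsys.equationError_ae_eq (by omega))).symm

end Data

/-! ### From coordinates to the Euclidean norm, and the main theorem -/

theorem tendsto_sqrt_log_div_atTop :
    Tendsto (fun k : ℕ => Real.sqrt (Real.log k / k)) atTop (𝓝 0) := by
  have h := (Real.isLittleO_log_id_atTop.tendsto_div_nhds_zero.comp
    tendsto_natCast_atTop_atTop).sqrt
  simpa using h

theorem euclNorm_isBigO {N : ℕ} {v : ℕ → Fin N → ℝ} {ρ : ℕ → ℝ}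
    (hv : ∀ i, (fun k => v k i) =O[atTop] ρ) : (fun k => euclNorm (v k)) =O[atTop] ρ := by
  refine IsBigO.of_pow two_ne_zero ?_
  have h : (fun k => euclNorm (v k)) ^ 2 = fun k => ∑ i, v k i ^ 2 := by
    ext k
    simp [euclNorm, EuclideanSpace.real_norm_sq_eq]
  rw [h]
  exact IsBigO.fun_sum fun i _ => (hv i).pow 2

end RLSSA

theorem theorem2 {Ω : Type*} [MeasurableSpace Ω] (μ : Measure Ω) [IsProbabilityMeasure μ]
    {m n : ℕ} (a : Fin m → ℝ) (b : Fin n → ℝ)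
    (y u : ℤ → Ω → ℝ) (d : ℕ → Ω → ℝ) (δd2 : NNReal)
    (hsys : RLSSA.IsARX μ a b y u d)
    (hdata : RLSSA.DataAssumption μ m n y u)
    (hstable : RLSSA.StableModel a)
    (hnoise : RLSSA.NoiseAssumption μ y u d δd2)
    (P₀ : Matrix (Fin (m + n)) (Fin (m + n)) ℝ) (hP₀ : P₀.PosDef)
    (ϑ₀ η₀ : Fin (m + n) → ℝ)
    (α : ℝ) (hα : 1 / 2 < α) (hα' : α < 1)
    (β : ℕ → ℝ) (βlow βhigh : ℝ) (hβlow : 0 < βlow)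
    (hβ : ∀ k, 1 ≤ k → βlow ≤ β k ∧ β k ≤ βhigh) :
    ∀ᵐ ω ∂μ,
      Tendsto (fun k : ℕ =>
        RLSSA.rlssa P₀ ϑ₀ η₀ α β (fun t => y t ω) (fun t => u t ω) k)
        atTop (𝓝 (RLSSA.param a b)) ∧
      (fun k : ℕ => RLSSA.euclNorm
        (RLSSA.rlssa P₀ ϑ₀ η₀ α β (fun t => y t ω) (fun t => u t ω) k - RLSSA.param a b))
        =O[atTop] (fun k : ℕ => Real.sqrt (Real.log k / k)) := by
  obtain ⟨M, hM, hlim⟩ := hdata.exists_ae_tendsto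
  -- The diagonal limits `M i i` supply the linear growth of squared regressors that the martingale
  -- bound needs.
  have hcorr := ae_all_iff.2 fun i => RLSSA.ae_regressor_mul_equationError_isBigO hsys hnoise i
    (q := M i i) (by
      filter_upwards [hlim] with ω hω
      simpa only [sq] using hω i i)
  filter_upwards [hlim, hcorr] with ω h1 h2
  have hrls := RLSSA.rlsEstimate_sub_isBigO hP₀
    (φ := RLSSA.regressor m n (fun t => y t ω) (fun t => u t ω))
    (y := fun k : ℕ => y (k : ℤ) ω) (w := fun k => RLSSA.equationError a b y u k ω)
    (θ := RLSSA.param a b) (fun k => by simp [RLSSA.equationError]) ϑ₀ hM h1 h2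
  have hsa := RLSSA.remoteEstimate_sub_isBigO hα hα' hβlow hβ η₀ (RLSSA.param a b) hrls
  refine ⟨tendsto_pi_nhds.2 fun i => ?_, RLSSA.euclNorm_isBigO hsa⟩
  exact tendsto_sub_nhds_zero_iff.1
    ((hsa i).trans_tendsto RLSSA.tendsto_sqrt_log_div_atTop)
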